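/- **Theorem 1.1.** Let $d,m$ be integers with $0<m\le d$, let $1\le p<\infty$ and let $D$ be a non-negative integer. There exist constants $\delta,C_1,C_2>0$ depending only on $d,p,m,D$ such that the following holds. Let $\rho:\mathbb R^d\to[0,\infty)$ be a smooth function that vanishes outside $\{y: \tfrac12<|y|<2\}$ and satisfies $\sum_{j\in\mathbb Z}\rho(2^{-j}y)=1$ for all $y\ne 0$, and put, for $s>0$, $$\|f\|_{\dot B^{s}_{p,1}}=\sum_{j\in\mathbb Z}2^{js}\,\bigl\|\mathcal F^{-1}[\rho(2^{-j}\cdot)\mathcal F f]\bigr\|_{L^p(\mathbb R^d)},$$ $\mathcal F$ being the Fourier transform of tempered distributions, and the $L^p$ norm of a distribution that is not given by an $L^p$ function being $\infty$. Let $f\in B^{m/p}_{p,1}(\mathbb R^d)$, that is, let $f:\mathbb R^d\to\mathbb C$ be in $L^p(\mathbb R^d)$ with $\|f\|_{\dot B^{m/p}_{p,1}}<\infty$. Write $\mathbb R^d=\mathbb R^{d-m}\times\mathbb R^m$. (a) There is a representative of $f$ (a function defined everywhere on $\mathbb R^d$ and equal to $f$ almost everywhere, again denoted by $f$) such that $f(\cdot,t)\in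 L^p(\mathbb R^{d-m})$ for every $t\in\mathbb R^m$ and $t\mapsto f(\cdot,t)$ is continuous from $\mathbb R^m$ to $L^p(\mathbb R^{d-m})$ (for $m=d$ this is the continuous representative of $f$). (b) Let $N,b>0$ be such that $\|f\|_{\dot B^{m/p}_{p,1}}\le N\|f\|_{L^p}$ and $b^{m/p}<\delta N^{-1}$. Let $E\subset\mathbb R^m$ be a discrete set such that $\bigcup_{x\in E}(x+[-b,b]^m)=\mathbb R^m$ and each point of $\mathbb R^m$ belongs to at most $D$ of the cubes $x+[-b,b]^m$, $x\in E$. Then for $G=\mathbb R^{d-m}\times E\subset\mathbb R^d$ and every representative of $f$ as in (a), $$C_1\|f\|_{L^p(\mathbb R^d)}\le b^{m/p}\left(\int_G|f(x)|^p\,d\mathcal H^{d-m}(x)\right)^{1/p}\le C_2\|f\|_{L^p(\mathbb R^d)},$$ where $\mathcal H^{d-m}$ is the $(d-m)$-dimensional Hausdorff measure, normalized to agree with Lebesgue measure on $(d-m)$-planes (counting measure if $m=d$). -/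

import Mathlib

open MeasureTheory Set Filter Topology
open scoped ENNReal SchwartzMap ContDiff

noncomputable section

namespace BesovSampling

/-- A generating function of a smooth dyadic (Littlewood–Paley) partition of unity on `ℝ^d`:
`ρ` is smooth, non-negative, vanishes outside the annulus `1/2 < |y| < 2`, and
`∑_{j ∈ ℤ} ρ(2^{-j} y) = 1` for every `y ≠ 0`. -/
structure IsDyadicPartition {d : ℕ} (ρ : EuclideanSpace ℝ (Fin d) → ℝ) : Prop where
  smooth : ContDiff ℝ ∞ ρ
  nonneg : ∀ y, 0 ≤ ρ y
  support_subset : Function.support ρ ⊆ {y | 1 / 2 < ‖y‖ ∧ ‖y‖ < 2}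
  hasSum_one : ∀ y, y ≠ 0 → HasSum (fun j : ℤ => ρ ((2 : ℝ) ^ (-j) • y)) 1

/-- The dyadic block `𝓕⁻¹[ρ(2^{-j} ·) 𝓕 u]` of a tempered distribution `u`. -/
def dyadicBlock {d : ℕ} (ρ : EuclideanSpace ℝ (Fin d) → ℝ) (j : ℤ)
    (u : 𝓢'(EuclideanSpace ℝ (Fin d), ℂ)) : 𝓢'(EuclideanSpace ℝ (Fin d), ℂ) :=
  TemperedDistribution.fourierMultiplierCLM ℂ
    (fun ξ => ((ρ ((2 : ℝ) ^ (-j) • ξ) : ℝ) : ℂ)) u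

/-- The `L^p` norm of a tempered distribution `u`: it is `‖g‖_p` if `u` is given by a function
`g ∈ L^p` (which is then unique), and `∞` if there is no such function. -/
def distLpNorm {d : ℕ} (p : ℝ≥0∞) [Fact (1 ≤ p)]
    (u : 𝓢'(EuclideanSpace ℝ (Fin d), ℂ)) : ℝ≥0∞ :=
  ⨅ (g : Lp ℂ p (volume : Measure (EuclideanSpace ℝ (Fin d))))
    (_ : (g : 𝓢'(EuclideanSpace ℝ (Fin d), ℂ)) = u), ‖g‖ₑ

/-- The homogeneous Besov norm with summation exponent `q = 1`,
`‖u‖_{Ḃ^s_{p,1}} = ∑_{j ∈ ℤ} 2^{js} ‖𝓕⁻¹[ρ(2^{-j} ·) 𝓕 u]‖_p ∈ [0, ∞]`. -/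
def homBesovNorm {d : ℕ} (ρ : EuclideanSpace ℝ (Fin d) → ℝ) (s : ℝ) (p : ℝ≥0∞) [Fact (1 ≤ p)]
    (u : 𝓢'(EuclideanSpace ℝ (Fin d), ℂ)) : ℝ≥0∞ :=
  ∑' j : ℤ, ENNReal.ofReal ((2 : ℝ) ^ ((j : ℝ) * s)) * distLpNorm p (dyadicBlock ρ j u)

/-- Membership of a function `f ∈ L^p` in the Besov space `B^s_{p,1} = L^p ∩ Ḃ^s_{p,1}`, `s > 0`. -/
def MemBesov {d : ℕ} (ρ : EuclideanSpace ℝ (Fin d) → ℝ) (s : ℝ) (p : ℝ≥0∞) [Fact (1 ≤ p)]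
    (f : Lp ℂ p (volume : Measure (EuclideanSpace ℝ (Fin d)))) : Prop :=
  homBesovNorm ρ s p (f : 𝓢'(EuclideanSpace ℝ (Fin d), ℂ)) < ⊤

/-- The point `(y, t)` of `ℝ^k × ℝ^m = ℝ^d`, where `k + m = d`. -/
def joinCoords {k m d : ℕ} (h : k + m = d) (y : EuclideanSpace ℝ (Fin k))
    (t : EuclideanSpace ℝ (Fin m)) : EuclideanSpace ℝ (Fin d) :=
  WithLp.toLp 2 (fun i => Fin.append (y : Fin k → ℝ) (t : Fin m → ℝ) (Fin.cast h.symm i))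

/-- `g`, a function defined at every point of `ℝ^d = ℝ^k × ℝ^m`, is a continuous representative of
`f ∈ L^p(ℝ^d)` along the `k`-planes `ℝ^k × {t}`: it equals `f` almost everywhere, each of its
restrictions `g(·, t)` is in `L^p(ℝ^k)`, and `t ↦ g(·, t)` is continuous from `ℝ^m` to `L^p(ℝ^k)`.
By continuity and Fubini's theorem, `f` determines the class of `g(·, t)` in `L^p(ℝ^k)` for every
`t`: it is the trace of `f` on `ℝ^k × {t}`. If `k = 0`, then `g` is the continuous
representative of `f`. -/
structure IsTraceRepresentative {k m d : ℕ} (h : k + m = d) (p : ℝ≥0∞)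
    (f g : EuclideanSpace ℝ (Fin d) → ℂ) : Prop where
  ae_eq : g =ᵐ[volume] f
  memLp : ∀ t : EuclideanSpace ℝ (Fin m),
    MemLp (fun y : EuclideanSpace ℝ (Fin k) => g (joinCoords h y t)) p volume
  continuous : ∀ t₀ : EuclideanSpace ℝ (Fin m),
    Tendsto (fun t : EuclideanSpace ℝ (Fin m) =>
      eLpNorm (fun y : EuclideanSpace ℝ (Fin k) => g (joinCoords h y t) - g (joinCoords h y t₀))
        p volume) (𝓝 t₀) (𝓝 0)

/-- The cube `[x - b, x + b]^m = ∏ᵢ [xᵢ - b, xᵢ + b]` in `ℝ^m`. -/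
def cube {m : ℕ} (x : EuclideanSpace ℝ (Fin m)) (b : ℝ) : Set (EuclideanSpace ℝ (Fin m)) :=
  {y | ∀ i, y i ∈ Icc (x i - b) (x i + b)}

/-- The union of `k`-planes `ℝ^k × E ⊆ ℝ^d`, where `k + m = d` and `E ⊆ ℝ^m`. -/
def planes {k m d : ℕ} (h : k + m = d) (E : Set (EuclideanSpace ℝ (Fin m))) :
    Set (EuclideanSpace ℝ (Fin d)) :=
  {x | ∃ y : EuclideanSpace ℝ (Fin k), ∃ t ∈ E, x = joinCoords h y t}

end BesovSampling

end

/-! A function T whose spectrum lies in |ξ| ≤ l is reproduced by convolution with l^d φ(l·), φ a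
fixed Schwartz function. Hence |T| is dominated pointwise by averages of |T| at scale 1/l, and its
increment along v by l|v| times the same averages. A weighted Young inequality integrates these
averages over the planes and yields two Plancherel–Pólya estimates on G = ℝ^k × E. Upper
(`exists_sampling_bound`): if lβ ≤ 1 and the cubes of half-side β overlap at most D times, then
β^{m/p}‖T‖_{L^p(G)} ≤ C D^{1/p}‖T‖_p. Lower (`exists_lower_bound`): if the cubes of half-side b also
cover and lb ≤ ε with ε small, then ‖T‖_p ≤ C b^{m/p}‖T‖_{L^p(G)}, since T oscillates little on each
cube and the error can be absorbed.

For general f, choose j₀ with 2^{j₀} b ≤ ε < 2^{j₀+1} b and write f = a + ∑ gₙ, where gₙ is the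
dyadic block of index j₀ + n and a has spectrum in |ξ| ≤ 2^{j₀} (`exists_decomposition`). The low
part a obeys both estimates. For gₙ the upper estimate is used with smaller cubes, of half-side
comparable to 2^{-(j₀+n)} and at most b, whose overlap is no worse; the price is the Besov weight
2^{(j₀+n)m/p}. So the high part, both in L^p(ℝ^d) and as b^{m/p} times its norm on G, is at most a
constant times b^{m/p}‖f‖_Ḃ ≤ b^{m/p} N‖f‖_p, which is small by the choice of δ. Thus f is a small
perturbation of a (`exists_sampling_constants`).

With E a single point the upper estimate is a trace inequality. It makes the series of traces
converge in L^p(ℝ^k) uniformly in t, which gives the continuous representative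
(`isTraceRepresentative_bandSeries`). Any two such representatives agree almost everywhere on every
plane, so the norm equivalence need only be proved for this one. -/

noncomputable section

namespace BesovSampling

/-! ### Coordinates, planes and cubes -/

section Geometry

variable {k m d : ℕ}

/-- The isometry `ℝ^k × ℝ^m ≃ ℝ^d` underlying `joinCoords`. -/
def joinIsometry (h : k + m = d) :
    WithLp 2 (EuclideanSpace ℝ (Fin k) × EuclideanSpace ℝ (Fin m)) ≃ₗᵢ[ℝ]
      EuclideanSpace ℝ (Fin d) :=
  (PiLp.sumPiLpEquivProdLpPiLp (𝕜 := ℝ) 2 (fun _ : Fin k ⊕ Fin m => ℝ)).symm.trans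
    (LinearIsometryEquiv.piLpCongrLeft 2 ℝ ℝ (finSumFinEquiv.trans (finCongr h)))

theorem joinIsometry_apply (h : k + m = d) (y : EuclideanSpace ℝ (Fin k))
    (t : EuclideanSpace ℝ (Fin m)) :
    joinIsometry h (WithLp.toLp 2 (y, t)) = joinCoords h y t := by
  subst h
  ext i
  refine Fin.addCases (fun i => ?_) (fun i => ?_) i
  · simp [joinIsometry, joinCoords, LinearIsometryEquiv.piLpCongrLeft_apply,
      Equiv.piCongrLeft'_apply]
  · simp [joinIsometry, joinCoords, LinearIsometryEquiv.piLpCongrLeft_apply,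
      Equiv.piCongrLeft'_apply]

theorem joinCoords_sub (h : k + m = d) (y y' : EuclideanSpace ℝ (Fin k))
    (t t' : EuclideanSpace ℝ (Fin m)) :
    joinCoords h y t - joinCoords h y' t' = joinCoords h (y - y') (t - t') := by
  simp only [← joinIsometry_apply, ← map_sub]
  rfl

theorem norm_joinCoords_sq (h : k + m = d) (y : EuclideanSpace ℝ (Fin k))
    (t : EuclideanSpace ℝ (Fin m)) : ‖joinCoords h y t‖ ^ 2 = ‖y‖ ^ 2 + ‖t‖ ^ 2 := by
  rw [← joinIsometry_apply, LinearIsometryEquiv.norm_map, WithLp.prod_norm_sq_eq_of_L2]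
  rfl

theorem norm_le_norm_joinCoords_left (h : k + m = d) (y : EuclideanSpace ℝ (Fin k))
    (t : EuclideanSpace ℝ (Fin m)) : ‖y‖ ≤ ‖joinCoords h y t‖ := by
  have := norm_joinCoords_sq h y t
  exact (sq_le_sq₀ (norm_nonneg _) (norm_nonneg _)).1 (by nlinarith [sq_nonneg ‖t‖])

theorem norm_le_norm_joinCoords_right (h : k + m = d) (y : EuclideanSpace ℝ (Fin k))
    (t : EuclideanSpace ℝ (Fin m)) : ‖t‖ ≤ ‖joinCoords h y t‖ := by
  have := norm_joinCoords_sq h y t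
  exact (sq_le_sq₀ (norm_nonneg _) (norm_nonneg _)).1 (by nlinarith [sq_nonneg ‖y‖])

theorem norm_joinCoords_zero_left (h : k + m = d) (t : EuclideanSpace ℝ (Fin m)) :
    ‖joinCoords h 0 t‖ = ‖t‖ := by
  have := norm_joinCoords_sq h 0 t
  rw [norm_zero, zero_pow two_ne_zero, zero_add] at this
  exact (sq_eq_sq₀ (norm_nonneg _) (norm_nonneg _)).1 this

theorem isometry_joinCoords_left (h : k + m = d) (t : EuclideanSpace ℝ (Fin m)) :
    Isometry (fun y : EuclideanSpace ℝ (Fin k) => joinCoords h y t) := by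
  refine Isometry.of_dist_eq fun y y' => ?_
  have := norm_joinCoords_sq h (y - y') 0
  rw [norm_zero, zero_pow two_ne_zero, add_zero] at this
  rw [dist_eq_norm, dist_eq_norm, joinCoords_sub, sub_self]
  exact (sq_eq_sq₀ (norm_nonneg _) (norm_nonneg _)).1 this

theorem measurePreserving_joinCoords (h : k + m = d) :
    MeasurePreserving (fun z : EuclideanSpace ℝ (Fin k) × EuclideanSpace ℝ (Fin m) =>
      joinCoords h z.1 z.2) := by
  have := (joinIsometry h).measurePreserving.comp
    (WithLp.volume_preserving_toLp (EuclideanSpace ℝ (Fin k)) (EuclideanSpace ℝ (Fin m)))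
  convert! this using 1
  ext1 z
  exact (joinIsometry_apply h z.1 z.2).symm

theorem surjective_joinCoords (h : k + m = d) (z : EuclideanSpace ℝ (Fin d)) :
    ∃ y t, joinCoords (k := k) (m := m) h y t = z := by
  obtain ⟨w, rfl⟩ := (joinIsometry h).surjective z
  exact ⟨w.fst, w.snd, (joinIsometry_apply h _ _).symm⟩

theorem joinCoords_injective (h : k + m = d) {y y' : EuclideanSpace ℝ (Fin k)}
    {t t' : EuclideanSpace ℝ (Fin m)} (H : joinCoords h y t = joinCoords h y' t') :
    y = y' ∧ t = t' := by
  have H' := joinCoords_sub h y y' t t'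
  rw [H, sub_self] at H'
  have H2 := norm_joinCoords_sq h (y - y') (t - t')
  rw [← H', norm_zero] at H2
  constructor
  · rw [← sub_eq_zero, ← norm_eq_zero]
    nlinarith [sq_nonneg ‖y - y'‖, sq_nonneg ‖t - t'‖]
  · rw [← sub_eq_zero, ← norm_eq_zero]
    nlinarith [sq_nonneg ‖y - y'‖, sq_nonneg ‖t - t'‖]

theorem measurableEmbedding_joinCoords_left (h : k + m = d) (t : EuclideanSpace ℝ (Fin m)) :
    MeasurableEmbedding (fun y : EuclideanSpace ℝ (Fin k) => joinCoords h y t) :=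
  (isometry_joinCoords_left h t).isClosedEmbedding.measurableEmbedding

/-- Integration over `ℝ^k × E`: the sum over `t ∈ E` of the Lebesgue measures of the planes
`ℝ^k × {t}`. -/
def planeMeasure (h : k + m = d) (E : Set (EuclideanSpace ℝ (Fin m))) :
    Measure (EuclideanSpace ℝ (Fin d)) :=
  Measure.sum fun t : E =>
    (volume : Measure (EuclideanSpace ℝ (Fin k))).map (fun y => joinCoords h y t)

theorem lintegral_planeMeasure (h : k + m = d) (E : Set (EuclideanSpace ℝ (Fin m)))
    (u : EuclideanSpace ℝ (Fin d) → ℝ≥0∞) :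
    ∫⁻ x, u x ∂planeMeasure h E = ∑' t : E, ∫⁻ y, u (joinCoords h y t) := by
  rw [planeMeasure, lintegral_sum_measure]
  congr 1 with t
  exact (measurableEmbedding_joinCoords_left h _).lintegral_map _

/-- Planes over distinct points are disjoint and each is an isometric copy of ℝ^k, on which the
normalized Hausdorff measure is Lebesgue measure. Countability of E allows the restriction to split
as a sum. -/
theorem restrict_planes_eq_planeMeasure (h : k + m = d) {E : Set (EuclideanSpace ℝ (Fin m))}
    (hE : E.Countable) :
    (μHE[k] : Measure (EuclideanSpace ℝ (Fin d))).restrict (planes h E) = planeMeasure h E := by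
  have : Countable E := hE
  have hU : planes h E =
      ⋃ t : E, Set.range (fun y : EuclideanSpace ℝ (Fin k) => joinCoords h y (t : _)) := by
    ext x
    simp only [planes, mem_ofPred_eq, mem_iUnion, mem_range]
    constructor
    · rintro ⟨y, t, ht, rfl⟩
      exact ⟨⟨t, ht⟩, y, rfl⟩
    · rintro ⟨⟨t, ht⟩, y, rfl⟩
      exact ⟨y, t, ht, rfl⟩
  rw [hU, Measure.restrict_iUnion, planeMeasure]
  · congr 1 with t : 1
    rw [← (isometry_joinCoords_left h (t : EuclideanSpace ℝ (Fin m))).map_euclideanHausdorffMeasure,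
      EuclideanSpace.euclideanHausdorffMeasure_eq_volume]
  · intro t t' htt'
    refine Set.disjoint_left.2 ?_
    rintro _ ⟨y, rfl⟩ ⟨y', hy'⟩
    exact htt' (Subtype.ext (joinCoords_injective h hy').2.symm)
  · exact fun t => (measurableEmbedding_joinCoords_left h _).measurableSet_range

theorem sFinite_planeMeasure (h : k + m = d) {E : Set (EuclideanSpace ℝ (Fin m))}
    (hE : E.Countable) : SFinite (planeMeasure h E) := by
  have : Countable E := hE
  unfold planeMeasure
  infer_instance

theorem countable_of_discreteTopology {E : Set (EuclideanSpace ℝ (Fin m))}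
    (hE : DiscreteTopology E) : E.Countable :=
  TopologicalSpace.separableSpace_iff_countable.1 inferInstance

theorem cube_eq_preimage (x : EuclideanSpace ℝ (Fin m)) (b : ℝ) :
    cube x b = (WithLp.ofLp : EuclideanSpace ℝ (Fin m) → Fin m → ℝ) ⁻¹'
      Icc (fun i => x i - b) (fun i => x i + b) := by
  ext y
  simp only [cube, mem_ofPred_eq, mem_preimage, mem_Icc, Pi.le_def]
  exact forall_and

theorem measurableSet_cube (x : EuclideanSpace ℝ (Fin m)) (b : ℝ) : MeasurableSet (cube x b) := by
  rw [cube_eq_preimage]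
  exact (PiLp.volume_preserving_ofLp (Fin m)).measurable measurableSet_Icc

theorem volume_cube (x : EuclideanSpace ℝ (Fin m)) {b : ℝ} (hb : 0 ≤ b) :
    volume (cube x b) = ENNReal.ofReal ((2 * b) ^ m) := by
  rw [cube_eq_preimage, (PiLp.volume_preserving_ofLp (Fin m)).measure_preimage
    measurableSet_Icc.nullMeasurableSet, Real.volume_Icc_pi,
    ← ENNReal.ofReal_prod_of_nonneg (fun i _ => by linarith)]
  rw [Finset.prod_congr rfl fun i _ => show x i + b - (x i - b) = 2 * b by ring]
  simp

theorem norm_sub_le_of_mem_cube {x y : EuclideanSpace ℝ (Fin m)} {b : ℝ} (hb : 0 ≤ b)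
    (hy : y ∈ cube x b) : ‖y - x‖ ≤ m * b := by
  rw [← sq_le_sq₀ (norm_nonneg _) (by positivity), EuclideanSpace.norm_sq_eq]
  calc ∑ i, ‖(y - x) i‖ ^ 2 ≤ ∑ i : Fin m, b ^ 2 := by
        refine Finset.sum_le_sum fun i _ => ?_
        have h1 := (hy i).1
        have h2 := (hy i).2
        have h3 : |y i - x i| ≤ b := abs_le.2 ⟨by linarith, by linarith⟩
        simpa using pow_le_pow_left₀ (abs_nonneg _) h3 2
    _ = m * b ^ 2 := by simp
    _ ≤ (m * b) ^ 2 := by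
        rw [mul_pow]
        gcongr
        rcases Nat.eq_zero_or_pos m with rfl | h
        · simp
        · exact le_self_pow₀ (by exact_mod_cast h) two_ne_zero

theorem cube_subset_cube (x : EuclideanSpace ℝ (Fin m)) {b b' : ℝ} (hb : b ≤ b') :
    cube x b ⊆ cube x b' :=
  fun _ hy i => ⟨by linarith [(hy i).1], by linarith [(hy i).2]⟩

/-- The form in which bounded overlap is used: it turns a sum over E of integrals over cubes into at
most D integrals over ℝ^m. -/
theorem tsum_indicator_cube_le {E : Set (EuclideanSpace ℝ (Fin m))} {b : ℝ} {D : ℕ}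
    (hD : ∀ y : EuclideanSpace ℝ (Fin m), {x ∈ E | y ∈ cube x b}.encard ≤ D)
    (y : EuclideanSpace ℝ (Fin m)) :
    ∑' t : E, (cube (t : EuclideanSpace ℝ (Fin m)) b).indicator (fun _ => (1 : ℝ≥0∞)) y ≤ D := by
  rw [tsum_subtype E fun t => (cube t b).indicator (fun _ => (1 : ℝ≥0∞)) y]
  calc ∑' t, E.indicator (fun t => (cube t b).indicator (fun _ => (1 : ℝ≥0∞)) y) t
      = ∑' t, {x ∈ E | y ∈ cube x b}.indicator (fun _ => (1 : ℝ≥0∞)) t := by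
        congr 1 with t
        by_cases h1 : t ∈ E <;> by_cases h2 : y ∈ cube t b <;> simp [h1, h2]
    _ = {x ∈ E | y ∈ cube x b}.encard := by
        rw [← tsum_subtype, ENNReal.tsum_set_one]
    _ ≤ D := by exact_mod_cast ENat.toENNReal_le.2 (hD y)

end Geometry

/-! ### Averages with polynomially decaying weights -/

section Averages

/-- The polynomially decaying profile `l^n (1 + l|x|)^{-e}` on `ℝ^n`. -/
def decay {n : ℕ} (e : ℕ) (l : ℝ) (x : EuclideanSpace ℝ (Fin n)) : ℝ≥0∞ :=
  ENNReal.ofReal (l ^ n * ((1 + l * ‖x‖) ^ e)⁻¹)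

/-- The integral of the profile `decay`, which does not depend on the scale. -/
def decayMass (n e : ℕ) : ℝ≥0∞ := ∫⁻ x : EuclideanSpace ℝ (Fin n), decay e 1 x

variable {n : ℕ}

@[fun_prop]
theorem measurable_decay (e : ℕ) (l : ℝ) :
    Measurable (decay e l : EuclideanSpace ℝ (Fin n) → ℝ≥0∞) := by
  unfold decay
  fun_prop

theorem decay_neg (e : ℕ) (l : ℝ) (x : EuclideanSpace ℝ (Fin n)) :
    decay e l (-x) = decay e l x := by
  simp [decay]

theorem decayMass_lt_top {e : ℕ} (he : n < e) : decayMass n e < ⊤ := by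
  have := finite_integral_one_add_norm (E := EuclideanSpace ℝ (Fin n)) (μ := volume) (r := e)
    (by simpa using he)
  refine lt_of_eq_of_lt (lintegral_congr fun x => ?_) this
  rw [decay, Real.rpow_neg (by positivity), Real.rpow_natCast]
  simp

theorem lintegral_comp_smul_pos (u : EuclideanSpace ℝ (Fin n) → ℝ≥0∞) (hu : Measurable u)
    {l : ℝ} (hl : 0 < l) :
    ENNReal.ofReal (l ^ n) * ∫⁻ x, u (l • x) = ∫⁻ x, u x := by
  have h1 : ∫⁻ x, u (l • x) = ENNReal.ofReal (l ^ n)⁻¹ * ∫⁻ x, u x := by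
    rw [← lintegral_map hu (measurable_const_smul l), Measure.map_addHaar_smul _ hl.ne',
      lintegral_smul_measure, finrank_euclideanSpace_fin, abs_of_pos (by positivity), smul_eq_mul]
  rw [h1, ← mul_assoc, ← ENNReal.ofReal_mul (by positivity), mul_inv_cancel₀ (by positivity),
    ENNReal.ofReal_one, one_mul]

theorem lintegral_decay (e : ℕ) {l : ℝ} (hl : 0 < l) :
    ∫⁻ x : EuclideanSpace ℝ (Fin n), decay e l x = decayMass n e := by
  rw [decayMass, ← lintegral_comp_smul_pos (decay e 1) (by fun_prop) hl,
    ← lintegral_const_mul _ (by fun_prop)]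
  refine lintegral_congr fun x => ?_
  rw [decay, decay, ← ENNReal.ofReal_mul (by positivity), norm_smul, Real.norm_of_nonneg hl.le]
  simp

theorem lintegral_decay_sub (e : ℕ) {l : ℝ} (hl : 0 < l) (z : EuclideanSpace ℝ (Fin n)) :
    ∫⁻ x : EuclideanSpace ℝ (Fin n), decay e l (x - z) = decayMass n e := by
  rw [lintegral_sub_right_eq_self (fun x => decay e l x) z, lintegral_decay e hl]

theorem lintegral_decay_sub' (e : ℕ) {l : ℝ} (hl : 0 < l) (x : EuclideanSpace ℝ (Fin n)) :
    ∫⁻ z : EuclideanSpace ℝ (Fin n), decay e l (x - z) = decayMass n e := by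
  rw [← lintegral_decay_sub e hl x]
  refine lintegral_congr fun z => ?_
  rw [← decay_neg, neg_sub]

/-- Both |y| and |t| are at most |(y, t)|, so the exponent d + 2 = (k + 1) + (m + 1) can be shared
between the two variables. Each share exceeds its dimension, which keeps both masses finite. -/
theorem decay_joinCoords_le {k m d : ℕ} (h : k + m = d) {l : ℝ} (hl : 0 < l)
    (y : EuclideanSpace ℝ (Fin k)) (t : EuclideanSpace ℝ (Fin m)) :
    decay (d + 2) l (joinCoords h y t) ≤ decay (k + 1) l y * decay (m + 1) l t := by
  have hy := norm_le_norm_joinCoords_left h y t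
  have ht := norm_le_norm_joinCoords_right h y t
  rw [decay, decay, decay, ← ENNReal.ofReal_mul (by positivity)]
  refine ENNReal.ofReal_le_ofReal ?_
  rw [mul_mul_mul_comm, ← pow_add, h, ← mul_inv]
  have : (1 + l * ‖y‖) ^ (k + 1) * (1 + l * ‖t‖) ^ (m + 1)
      ≤ (1 + l * ‖joinCoords h y t‖) ^ (d + 2) := by
    rw [show d + 2 = (k + 1) + (m + 1) by omega, pow_add _ (k + 1)]
    gcongr
  exact mul_le_mul_of_nonneg_left (inv_anti₀ (by positivity) this) (by positivity)

/-- Jensen's inequality for a weight of finite mass. -/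
theorem lintegral_mul_rpow_le {α : Type*} [MeasurableSpace α] {μ : Measure α} {w u : α → ℝ≥0∞}
    (hw : Measurable w) (hu : Measurable u) {q : ℝ} (hq : 1 ≤ q) :
    (∫⁻ z, w z * u z ∂μ) ^ q ≤ (∫⁻ z, w z ∂μ) ^ (q - 1) * ∫⁻ z, w z * u z ^ q ∂μ := by
  have hq0 : 0 < q := by linarith
  -- Comparison of the exponents 1 and q for the measure with density w.
  have := eLpNorm'_le_eLpNorm'_mul_rpow_measure_univ (μ := μ.withDensity w) (f := u) zero_lt_one hq
    hu.aestronglyMeasurable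
  rw [eLpNorm', eLpNorm'] at this
  simp only [enorm_eq_self, ENNReal.rpow_one, div_one] at this
  rw [lintegral_withDensity_eq_lintegral_mul _ hw hu,
    lintegral_withDensity_eq_lintegral_mul _ hw (by fun_prop), withDensity_apply _ .univ,
    Measure.restrict_univ] at this
  calc _ ≤ _ := ENNReal.rpow_le_rpow this hq0.le
    _ = _ := by
      rw [ENNReal.mul_rpow_of_nonneg _ _ hq0.le, ← ENNReal.rpow_mul, ← ENNReal.rpow_mul,
        one_div_mul_cancel hq0.ne', ENNReal.rpow_one, mul_comm, sub_mul,
        one_div_mul_cancel hq0.ne']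
      simp

variable {d : ℕ}

/-- The average of `u` at scale `l⁻¹`. -/
def average (l : ℝ) (u : EuclideanSpace ℝ (Fin d) → ℝ≥0∞) (x : EuclideanSpace ℝ (Fin d)) : ℝ≥0∞ :=
  ∫⁻ z, decay (d + 2) l (x - z) * u z

theorem measurable_average (l : ℝ) {u : EuclideanSpace ℝ (Fin d) → ℝ≥0∞} (hu : Measurable u) :
    Measurable (average l u) := by
  unfold average
  exact Measurable.lintegral_prod_right' (f := fun z : _ × _ => decay (d + 2) l (z.1 - z.2) * u z.2)
    (by fun_prop)

/-- A weighted form of Young's inequality for averages. -/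
theorem lintegral_average_rpow_le {l : ℝ} (hl : 0 < l) {u : EuclideanSpace ℝ (Fin d) → ℝ≥0∞}
    (hu : Measurable u) {q : ℝ} (hq : 1 ≤ q) (ν : Measure (EuclideanSpace ℝ (Fin d))) [SFinite ν]
    {A : ℝ≥0∞} (hA : ∀ z, ∫⁻ x, decay (d + 2) l (x - z) ∂ν ≤ A) :
    ∫⁻ x, average l u x ^ q ∂ν ≤ decayMass d (d + 2) ^ (q - 1) * A * ∫⁻ z, u z ^ q := by
  calc ∫⁻ x, average l u x ^ q ∂ν
      ≤ ∫⁻ x, decayMass d (d + 2) ^ (q - 1) *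
          (∫⁻ z, decay (d + 2) l (x - z) * u z ^ q) ∂ν := by
        refine lintegral_mono fun x => ?_
        have := lintegral_mul_rpow_le (μ := volume) (w := fun z => decay (d + 2) l (x - z))
          (by fun_prop) hu hq
        rwa [lintegral_decay_sub' _ hl] at this
    _ = decayMass d (d + 2) ^ (q - 1) *
          ∫⁻ x, (∫⁻ z, decay (d + 2) l (x - z) * u z ^ q) ∂ν :=
        lintegral_const_mul' _ _
          (ENNReal.rpow_ne_top_of_nonneg (by linarith) (decayMass_lt_top (by omega)).ne)
    _ = decayMass d (d + 2) ^ (q - 1) *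
          ∫⁻ z, (∫⁻ x, decay (d + 2) l (x - z) * u z ^ q ∂ν) := by
        rw [lintegral_lintegral_swap]
        exact Measurable.aemeasurable (by fun_prop)
    _ ≤ decayMass d (d + 2) ^ (q - 1) * ∫⁻ z, A * u z ^ q := by
        gcongr with z
        rw [lintegral_mul_const _ (by fun_prop)]
        gcongr
        exact hA z
    _ = _ := by
        rw [lintegral_const_mul _ (by fun_prop), mul_assoc]

theorem lintegral_average_rpow_volume_le {l : ℝ} (hl : 0 < l)
    {u : EuclideanSpace ℝ (Fin d) → ℝ≥0∞} (hu : Measurable u) {q : ℝ} (hq : 1 ≤ q) :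
    ∫⁻ x, average l u x ^ q ≤ decayMass d (d + 2) ^ q * ∫⁻ z, u z ^ q := by
  refine (lintegral_average_rpow_le hl hu hq volume
    fun z => (lintegral_decay_sub _ hl z).le).trans_eq ?_
  congr 1
  have hI : decayMass d (d + 2) ≠ ⊤ := (decayMass_lt_top (by omega)).ne
  calc _ = decayMass d (d + 2) ^ (q - 1) * decayMass d (d + 2) ^ (1 : ℝ) := by simp
    _ = _ := by
      rw [← ENNReal.rpow_add_of_nonneg _ _ (by linarith) zero_le_one]
      simp

variable {k m : ℕ}

/-- Because lβ ≤ 1, the weight at the centre of a cube is at most (1 + m)^{m+1} times its value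
anywhere in the cube. The centre value may therefore be replaced by a mean over the cube, and
bounded overlap compares the sum of these means with the full integral. -/
theorem tsum_decay_le {l β : ℝ} (hl : 0 < l) (hβ : 0 < β) (hlβ : l * β ≤ 1)
    {E : Set (EuclideanSpace ℝ (Fin m))} (hE : E.Countable) {D : ℕ}
    (hD : ∀ y : EuclideanSpace ℝ (Fin m), {x ∈ E | y ∈ cube x β}.encard ≤ D)
    (z : EuclideanSpace ℝ (Fin m)) :
    ∑' t : E, decay (m + 1) l ((t : EuclideanSpace ℝ (Fin m)) - z) ≤
      ENNReal.ofReal (((1 + m) ^ (m + 1) : ℝ) * ((2 * β) ^ m)⁻¹) * D * decayMass m (m + 1) := by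
  have : Countable E := hE
  have hpt : ∀ t : E, decay (m + 1) l ((t : EuclideanSpace ℝ (Fin m)) - z) ≤
      ENNReal.ofReal (((1 + m) ^ (m + 1) : ℝ) * ((2 * β) ^ m)⁻¹) *
        ∫⁻ x, (cube (t : EuclideanSpace ℝ (Fin m)) β).indicator (fun _ => (1 : ℝ≥0∞)) x *
          decay (m + 1) l (x - z) := by
    intro t
    have hpos : (0 : ℝ) < (2 * β) ^ m := by positivity
    have hle : ∀ x ∈ cube (t : EuclideanSpace ℝ (Fin m)) β, decay (m + 1) l ((t : EuclideanSpace ℝ (Fin m)) - z) ≤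
        ENNReal.ofReal ((1 + m) ^ (m + 1) : ℝ) * decay (m + 1) l (x - z) := by
      intro x hx
      rw [decay, decay, ← ENNReal.ofReal_mul (by positivity)]
      refine ENNReal.ofReal_le_ofReal ?_
      have h1 : ‖x - z‖ ≤ m * β + ‖(t : EuclideanSpace ℝ (Fin m)) - z‖ := by
        have := norm_add_le (x - t) ((t : EuclideanSpace ℝ (Fin m)) - z)
        rw [sub_add_sub_cancel] at this
        linarith [norm_sub_le_of_mem_cube hβ.le hx]
      have h2 : 1 + l * ‖x - z‖ ≤ (1 + m) * (1 + l * ‖(t : EuclideanSpace ℝ (Fin m)) - z‖) := by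
        have h3 : l * ‖x - z‖ ≤ l * (m * β + ‖(t : EuclideanSpace ℝ (Fin m)) - z‖) := by gcongr
        have h4 : (m : ℝ) * (l * β) ≤ m * 1 := by gcongr
        have h5 : 0 ≤ m * (l * ‖(t : EuclideanSpace ℝ (Fin m)) - z‖) := by positivity
        nlinarith
      have h6 : (1 + l * ‖x - z‖) ^ (m + 1) ≤
          (1 + m) ^ (m + 1) * (1 + l * ‖(t : EuclideanSpace ℝ (Fin m)) - z‖) ^ (m + 1) := by
        rw [← mul_pow]
        gcongr
      rw [mul_left_comm]
      refine mul_le_mul_of_nonneg_left ?_ (by positivity)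
      rw [inv_le_iff_one_le_mul₀ (by positivity), ← div_eq_mul_inv, div_mul_eq_mul_div,
        one_le_div (by positivity)]
      exact h6
    calc decay (m + 1) l ((t : EuclideanSpace ℝ (Fin m)) - z)
        = ENNReal.ofReal ((2 * β) ^ m)⁻¹ *
            ∫⁻ x in cube (t : EuclideanSpace ℝ (Fin m)) β, decay (m + 1) l ((t : EuclideanSpace ℝ (Fin m)) - z) := by
          rw [setLIntegral_const, volume_cube _ hβ.le, mul_left_comm,
            ← ENNReal.ofReal_mul (by positivity), inv_mul_cancel₀ hpos.ne', ENNReal.ofReal_one,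
            mul_one]
      _ ≤ ENNReal.ofReal ((2 * β) ^ m)⁻¹ * ∫⁻ x in cube (t : EuclideanSpace ℝ (Fin m)) β,
            ENNReal.ofReal ((1 + m) ^ (m + 1) : ℝ) * decay (m + 1) l (x - z) := by
          refine mul_le_mul_right ?_ _
          exact setLIntegral_mono' (measurableSet_cube _ _) hle
      _ = _ := by
          rw [lintegral_const_mul _ (by fun_prop), ← mul_assoc,
            ← ENNReal.ofReal_mul (by positivity), mul_comm ((2 * β) ^ m)⁻¹,
            ← lintegral_indicator (measurableSet_cube _ _)]
          congr 2 with x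
          by_cases hx : x ∈ cube (t : EuclideanSpace ℝ (Fin m)) β <;> simp [hx]
  have hmeas : ∀ t : E, Measurable fun x : EuclideanSpace ℝ (Fin m) =>
      (cube (t : EuclideanSpace ℝ (Fin m)) β).indicator (fun _ => (1 : ℝ≥0∞)) x :=
    fun t => measurable_const.indicator (measurableSet_cube _ _)
  calc _ ≤ _ := ENNReal.tsum_le_tsum hpt
    _ = ENNReal.ofReal (((1 + m) ^ (m + 1) : ℝ) * ((2 * β) ^ m)⁻¹) *
          ∫⁻ x, (∑' t : E, (cube (t : EuclideanSpace ℝ (Fin m)) β).indicator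
            (fun _ => (1 : ℝ≥0∞)) x) * decay (m + 1) l (x - z) := by
        rw [ENNReal.tsum_mul_left, ← lintegral_tsum]
        · simp_rw [ENNReal.tsum_mul_right]
        · exact fun t => ((hmeas t).mul (by fun_prop)).aemeasurable
    _ ≤ ENNReal.ofReal (((1 + m) ^ (m + 1) : ℝ) * ((2 * β) ^ m)⁻¹) *
          ∫⁻ x, D * decay (m + 1) l (x - z) := by
        gcongr with x
        exact tsum_indicator_cube_le hD x
    _ = _ := by
        rw [lintegral_const_mul _ (by fun_prop), lintegral_decay_sub _ hl, mul_assoc]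

/-- The constant in `lintegral_average_rpow_planeMeasure_le`. -/
def samplingConst (k m d : ℕ) (q : ℝ) : ℝ≥0∞ :=
  decayMass d (d + 2) ^ (q - 1) * (decayMass k (k + 1) *
    (ENNReal.ofReal ((1 + m) ^ (m + 1) : ℝ) * decayMass m (m + 1)))

theorem samplingConst_lt_top (k m d : ℕ) {q : ℝ} (hq : 1 ≤ q) : samplingConst k m d q < ⊤ :=
  ENNReal.mul_lt_top (ENNReal.rpow_lt_top_of_nonneg (by linarith) (decayMass_lt_top (by omega)).ne)
    (ENNReal.mul_lt_top (decayMass_lt_top (by omega))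
      (ENNReal.mul_lt_top ENNReal.ofReal_lt_top (decayMass_lt_top (by omega))))

/-- Weighted Young inequality with the plane measure. Its hypothesis splits by `decay_joinCoords_le`
into an integral along ℝ^k and a sum over E, the latter bounded by `tsum_decay_le`. -/
theorem lintegral_average_rpow_planeMeasure_le (h : k + m = d) {l β : ℝ} (hl : 0 < l) (hβ : 0 < β)
    (hlβ : l * β ≤ 1) {E : Set (EuclideanSpace ℝ (Fin m))} (hE : E.Countable) {D : ℕ}
    (hD : ∀ y : EuclideanSpace ℝ (Fin m), {x ∈ E | y ∈ cube x β}.encard ≤ D)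
    {u : EuclideanSpace ℝ (Fin d) → ℝ≥0∞} (hu : Measurable u) {q : ℝ} (hq : 1 ≤ q) :
    ∫⁻ x, average l u x ^ q ∂planeMeasure h E ≤
      samplingConst k m d q * D * ENNReal.ofReal ((2 * β) ^ m)⁻¹ * ∫⁻ z, u z ^ q := by
  have := sFinite_planeMeasure h hE
  have hA : ∀ z, ∫⁻ x, decay (d + 2) l (x - z) ∂planeMeasure h E ≤ decayMass k (k + 1) *
      (ENNReal.ofReal (((1 + m) ^ (m + 1) : ℝ) * ((2 * β) ^ m)⁻¹) * D * decayMass m (m + 1)) := by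
    intro z
    obtain ⟨y', t', rfl⟩ := surjective_joinCoords h z
    rw [lintegral_planeMeasure]
    calc _ ≤ ∑' t : E, decayMass k (k + 1) * decay (m + 1) l ((t : EuclideanSpace ℝ (Fin m)) - t') := by
          refine ENNReal.tsum_le_tsum fun t => ?_
          rw [← lintegral_decay_sub (k + 1) hl y', ← lintegral_mul_const _ (by fun_prop)]
          refine lintegral_mono fun y => ?_
          rw [joinCoords_sub]
          exact decay_joinCoords_le h hl _ _
      _ ≤ _ := by
          rw [ENNReal.tsum_mul_left]
          gcongr
          exact tsum_decay_le hl hβ hlβ hE hD t'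
  refine (lintegral_average_rpow_le hl hu hq _ hA).trans_eq ?_
  rw [samplingConst, ENNReal.ofReal_mul (by positivity)]
  ring

end Averages

/-! ### Convolution with a dilated Schwartz kernel -/

section BandConv

variable {d : ℕ}

/-- The increment is controlled by the mean value inequality on the segment from x to x + h. A
displacement of length at most R changes 1 + |x| by a factor at most 1 + |R|, so the decay of the
derivative can be expressed at x; this costs (1 + |R|)^e. -/
theorem exists_kernel_bound (φ : 𝓢(EuclideanSpace ℝ (Fin d), ℂ)) (e : ℕ) (R : ℝ) :
    ∃ C : ℝ, 0 < C ∧ (∀ x, ‖φ x‖ ≤ C * ((1 + ‖x‖) ^ e)⁻¹) ∧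
      ∀ x h, ‖h‖ ≤ R → ‖φ (x + h) - φ x‖ ≤ C * ‖h‖ * ((1 + ‖x‖) ^ e)⁻¹ := by
  obtain ⟨C, hC, h0, h1⟩ : ∃ C : ℝ, 0 ≤ C ∧ (∀ x, ‖φ x‖ ≤ C * ((1 + ‖x‖) ^ e)⁻¹) ∧
      ∀ x, ‖fderiv ℝ φ x‖ ≤ C * ((1 + ‖x‖) ^ e)⁻¹ := by
    refine ⟨2 ^ e * ((Finset.Iic (e, 1)).sup fun m => SchwartzMap.seminorm ℝ m.1 m.2) φ,
      by positivity, fun x => ?_, fun x => ?_⟩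
    · have := SchwartzMap.one_add_le_sup_seminorm_apply (𝕜 := ℝ) (m := (e, 1)) le_rfl
        (Nat.zero_le _) φ x
      rw [norm_iteratedFDeriv_zero] at this
      rw [← div_eq_mul_inv, le_div_iff₀ (by positivity), mul_comm]
      exact this
    · have := SchwartzMap.one_add_le_sup_seminorm_apply (𝕜 := ℝ) (m := (e, 1)) le_rfl
        le_rfl φ x
      rw [norm_iteratedFDeriv_one] at this
      rw [← div_eq_mul_inv, le_div_iff₀ (by positivity), mul_comm]
      exact this
  refine ⟨C * (1 + |R|) ^ e + 1, by positivity, fun x => (h0 x).trans ?_, fun x h hR => ?_⟩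
  · gcongr
    have : (1 : ℝ) ≤ (1 + |R|) ^ e := one_le_pow₀ (by simp)
    nlinarith
  · have key := (convex_segment x (x + h)).norm_image_sub_le_of_norm_fderiv_le
      (f := φ) (𝕜 := ℝ) (C := (C * (1 + |R|) ^ e + 1) * ((1 + ‖x‖) ^ e)⁻¹)
      (fun y _ => φ.differentiableAt) (fun y hy => ?_)
      (left_mem_segment ℝ _ _) (right_mem_segment ℝ _ _)
    · rw [add_sub_cancel_left] at key
      linarith
    · refine (h1 y).trans ?_
      obtain ⟨s, hs, rfl⟩ := (segment_eq_image' ℝ x (x + h) ▸ hy)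
      simp only [add_sub_cancel_left]
      have h2 : ‖x‖ ≤ ‖x + s • h‖ + |R| := by
        have h3 := norm_sub_le (x + s • h) (s • h)
        rw [add_sub_cancel_right, norm_smul, Real.norm_of_nonneg hs.1] at h3
        have h4 : s * ‖h‖ ≤ 1 * |R| := by
          have := hR.trans (le_abs_self R)
          gcongr
          exact hs.2
        linarith
      have h5 : (1 + ‖x‖) ^ e ≤ (1 + |R|) ^ e * (1 + ‖x + s • h‖) ^ e := by
        rw [← mul_pow]
        gcongr
        nlinarith [norm_nonneg (x + s • h), abs_nonneg R]
      rw [← div_eq_mul_inv, ← div_eq_mul_inv, div_le_div_iff₀ (by positivity) (by positivity)]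
      have : 0 ≤ (1 + ‖x + s • h‖) ^ e := by positivity
      nlinarith [mul_le_mul_of_nonneg_left h5 hC]

/-- The function `z ↦ φ (l (x - z))` as a Schwartz function. -/
def reflectedDilate (φ : 𝓢(EuclideanSpace ℝ (Fin d), ℂ)) {l : ℝ} (hl : l ≠ 0)
    (x : EuclideanSpace ℝ (Fin d)) : 𝓢(EuclideanSpace ℝ (Fin d), ℂ) :=
  SchwartzMap.compSubConstCLM ℂ x (SchwartzMap.compCLMOfContinuousLinearEquiv ℂ
    (ContinuousLinearEquiv.smulLeft (Units.mk0 (-l) (neg_ne_zero.2 hl))) φ)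

theorem reflectedDilate_apply (φ : 𝓢(EuclideanSpace ℝ (Fin d), ℂ)) {l : ℝ} (hl : l ≠ 0)
    (x z : EuclideanSpace ℝ (Fin d)) : reflectedDilate φ hl x z = φ (l • (x - z)) := by
  simp [reflectedDilate, Units.smul_def, ← smul_neg]

/-- The convolution of `T` with the kernel `l^d φ(l ·)`. -/
def bandConv (φ : 𝓢(EuclideanSpace ℝ (Fin d), ℂ)) (l : ℝ) (T : EuclideanSpace ℝ (Fin d) → ℂ)
    (x : EuclideanSpace ℝ (Fin d)) : ℂ :=
  ∫ z, (l : ℂ) ^ d * φ (l • (x - z)) * T z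

variable {φ : 𝓢(EuclideanSpace ℝ (Fin d), ℂ)} {T : EuclideanSpace ℝ (Fin d) → ℂ} {p : ℝ≥0∞}

theorem measurable_bandConv (l : ℝ) (hT : Measurable T) : Measurable (bandConv φ l T) := by
  have : Measurable φ := φ.continuous.measurable
  exact (StronglyMeasurable.integral_prod_right' (f := fun z : _ × _ =>
    (l : ℂ) ^ d * φ (l • (z.1 - z.2)) * T z.2)
    (Measurable.stronglyMeasurable (by fun_prop))).measurable

theorem integrable_bandConv [Fact (1 ≤ p)] {l : ℝ} (hl : 0 < l) (hT : MemLp T p)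
    (x : EuclideanSpace ℝ (Fin d)) :
    Integrable fun z => (l : ℂ) ^ d * φ (l • (x - z)) * T z := by
  have hpq : ENNReal.HolderConjugate p (1 - p⁻¹)⁻¹ :=
    ENNReal.HolderConjugate.inv_one_sub_inv' Fact.out
  have h1 := ((reflectedDilate φ hl.ne' x).memLp (1 - p⁻¹)⁻¹ volume).integrable_mul hT
  refine (h1.const_mul ((l : ℂ) ^ d)).congr (Eventually.of_forall fun z => ?_)
  simp [reflectedDilate_apply, mul_assoc]

theorem lintegral_enorm_kernel_mul_le {l C : ℝ} (hl : 0 < l)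
    (hC : ∀ x, ‖φ x‖ ≤ C * ((1 + ‖x‖) ^ (d + 2))⁻¹) (x : EuclideanSpace ℝ (Fin d)) :
    ∫⁻ z, ‖(l : ℂ) ^ d * φ (l • (x - z)) * T z‖ₑ ≤
      ENNReal.ofReal C * average l (fun z => ‖T z‖ₑ) x := by
  have hC0 : 0 ≤ C := by simpa using (norm_nonneg _).trans (hC 0)
  rw [average, ← lintegral_const_mul' _ _ ENNReal.ofReal_ne_top]
  refine lintegral_mono fun z => ?_
  rw [enorm_mul, ← mul_assoc]
  gcongr
  rw [decay, ← ENNReal.ofReal_mul hC0, ← ofReal_norm]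
  refine ENNReal.ofReal_le_ofReal ?_
  rw [norm_mul, norm_pow, Complex.norm_of_nonneg hl.le, mul_left_comm]
  gcongr
  refine (hC _).trans_eq ?_
  rw [norm_smul, Real.norm_of_nonneg hl.le]

theorem enorm_bandConv_le {l C : ℝ} (hl : 0 < l)
    (hC : ∀ x, ‖φ x‖ ≤ C * ((1 + ‖x‖) ^ (d + 2))⁻¹) (x : EuclideanSpace ℝ (Fin d)) :
    ‖bandConv φ l T x‖ₑ ≤ ENNReal.ofReal C * average l (fun z => ‖T z‖ₑ) x :=
  (enorm_integral_le_lintegral_enorm _).trans (lintegral_enorm_kernel_mul_le hl hC x)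

/-- Bernstein-type estimate: the difference falls on the kernel, whose increments decay like the
kernel itself. The average stays centred at x, not at x + v. -/
theorem enorm_bandConv_add_sub_le [Fact (1 ≤ p)] {l C R : ℝ} (hl : 0 < l) (hC0 : 0 ≤ C)
    (hC : ∀ x h, ‖h‖ ≤ R → ‖φ (x + h) - φ x‖ ≤ C * ‖h‖ * ((1 + ‖x‖) ^ (d + 2))⁻¹)
    (hT : MemLp T p) (x : EuclideanSpace ℝ (Fin d)) {v : EuclideanSpace ℝ (Fin d)}
    (hv : l * ‖v‖ ≤ R) :
    ‖bandConv φ l T (x + v) - bandConv φ l T x‖ₑ ≤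
      ENNReal.ofReal (C * (l * ‖v‖)) * average l (fun z => ‖T z‖ₑ) x := by
  have hnv : ‖l • v‖ = l * ‖v‖ := by rw [norm_smul, Real.norm_of_nonneg hl.le]
  rw [bandConv, bandConv, ← integral_sub (integrable_bandConv hl hT _)
    (integrable_bandConv hl hT _)]
  refine (enorm_integral_le_lintegral_enorm _).trans ?_
  rw [average, ← lintegral_const_mul' _ _ ENNReal.ofReal_ne_top]
  refine lintegral_mono fun z => ?_
  rw [← sub_mul, ← mul_sub, enorm_mul, ← mul_assoc]
  gcongr
  rw [decay, ← ENNReal.ofReal_mul (by positivity), ← ofReal_norm]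
  refine ENNReal.ofReal_le_ofReal ?_
  rw [norm_mul, norm_pow, Complex.norm_of_nonneg hl.le, mul_left_comm]
  gcongr
  rw [show l • (x + v - z) = l • (x - z) + l • v by module]
  refine (hC _ _ (hnv.trans_le hv)).trans_eq ?_
  rw [hnv, norm_smul, Real.norm_of_nonneg hl.le]

theorem eLpNorm_le_of_enorm_le_average (hp0 : p ≠ 0) (hp : p ≠ ⊤)
    {ν : Measure (EuclideanSpace ℝ (Fin d))} {g : EuclideanSpace ℝ (Fin d) → ℂ} {a S : ℝ≥0∞}
    {l : ℝ} (hg : ∀ x, ‖g x‖ₑ ≤ a * average l (fun z => ‖T z‖ₑ) x) (ha : a ≠ ⊤)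
    (hS : ∫⁻ x, average l (fun z => ‖T z‖ₑ) x ^ p.toReal ∂ν ≤ S * ∫⁻ z, ‖T z‖ₑ ^ p.toReal) :
    eLpNorm g p ν ≤ a * S ^ (1 / p.toReal) * eLpNorm T p volume := by
  have hq : 0 < p.toReal := ENNReal.toReal_pos hp0 hp
  rw [eLpNorm_eq_lintegral_rpow_enorm_toReal hp0 hp, eLpNorm_eq_lintegral_rpow_enorm_toReal hp0 hp]
  calc (∫⁻ x, ‖g x‖ₑ ^ p.toReal ∂ν) ^ (1 / p.toReal)
      ≤ (∫⁻ x, a ^ p.toReal * average l (fun z => ‖T z‖ₑ) x ^ p.toReal ∂ν) ^ (1 / p.toReal) := by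
        gcongr with x
        rw [← ENNReal.mul_rpow_of_nonneg _ _ hq.le]
        gcongr
        exact hg x
    _ = (a ^ p.toReal * ∫⁻ x, average l (fun z => ‖T z‖ₑ) x ^ p.toReal ∂ν) ^ (1 / p.toReal) := by
        rw [lintegral_const_mul' _ _ (ENNReal.rpow_ne_top_of_nonneg hq.le ha)]
    _ ≤ (a ^ p.toReal * (S * ∫⁻ z, ‖T z‖ₑ ^ p.toReal)) ^ (1 / p.toReal) := by gcongr
    _ = _ := by
        rw [ENNReal.mul_rpow_of_nonneg _ _ (by positivity),
          ENNReal.mul_rpow_of_nonneg _ _ (by positivity), ← ENNReal.rpow_mul,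
          mul_one_div_cancel hq.ne', ENNReal.rpow_one, mul_assoc]

end BandConv

open FourierTransform

/-! ### Fourier multipliers as convolutions -/

section Multiplier

variable {d : ℕ}

theorem hasTemperateGrowth_dilate (χ : 𝓢(EuclideanSpace ℝ (Fin d), ℂ)) (l : ℝ) :
    (fun ξ => χ (l • ξ)).HasTemperateGrowth :=
  χ.hasTemperateGrowth.comp
    (l • ContinuousLinearMap.id ℝ (EuclideanSpace ℝ (Fin d))).hasTemperateGrowth

/-- Computes the transpose of the multiplier on test functions. The kernel is evaluated at x - y
with integration over x, so pairing with T and exchanging integrals produces `bandConv`. -/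
theorem fourier_smul_fourierInv_apply (χ u : 𝓢(EuclideanSpace ℝ (Fin d), ℂ)) {l : ℝ} (hl : 0 < l)
    (y : EuclideanSpace ℝ (Fin d)) :
    𝓕 (SchwartzMap.smulLeftCLM ℂ (fun ξ => χ (l⁻¹ • ξ)) (𝓕⁻ u)) y =
      ∫ x, u x * ((l : ℂ) ^ d * (𝓕⁻ χ) (l • (x - y))) := by
  have hχ : Integrable fun ξ => χ (l⁻¹ • ξ) :=
    χ.integrable.comp_smul (inv_ne_zero hl.ne')
  have hg : Integrable fun ξ : EuclideanSpace ℝ (Fin d) =>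
      Real.fourierChar (-inner ℝ ξ y) • χ (l⁻¹ • ξ) :=
    (Real.fourierIntegral_convergent_iff (f := fun ξ => χ (l⁻¹ • ξ)) y).2 hχ
  -- The Fourier integral moves across the pairing. The negated inner product makes the transform of
  -- u the inverse one.
  have h1 := VectorFourier.integral_fourierIntegral_smul_eq_flip (e := Real.fourierChar)
    (μ := volume) (ν := volume) (L := -innerₗ (EuclideanSpace ℝ (Fin d)))
    Real.continuous_fourierChar (by simpa using! continuous_inner.neg) u.integrable hg
  have h2 : ∀ ξ, VectorFourier.fourierIntegral Real.fourierChar volume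
      (-innerₗ (EuclideanSpace ℝ (Fin d))) u ξ = (𝓕⁻ u) ξ := by
    intro ξ
    rw [SchwartzMap.fourierInv_coe]
    rfl
  have h3 : ∀ x, VectorFourier.fourierIntegral Real.fourierChar volume
      (-innerₗ (EuclideanSpace ℝ (Fin d))).flip
      (fun ξ => Real.fourierChar (-inner ℝ ξ y) • χ (l⁻¹ • ξ)) x =
        (l : ℂ) ^ d * (𝓕⁻ χ) (l • (x - y)) := by
    intro x
    have h4 := Measure.integral_comp_smul_of_nonneg (volume : Measure (EuclideanSpace ℝ (Fin d)))
      (fun ξ => Real.fourierChar (inner ℝ ξ (l • (x - y))) • χ ξ) l⁻¹ (hR := by positivity)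
    rw [SchwartzMap.fourierInv_coe, Real.fourierInv_eq]
    rw [finrank_euclideanSpace_fin, inv_pow, inv_inv] at h4
    have h5 : (l : ℂ) ^ d * ∫ ξ, Real.fourierChar (inner ℝ ξ (l • (x - y))) • χ ξ =
        l ^ d • ∫ ξ, Real.fourierChar (inner ℝ ξ (l • (x - y))) • χ ξ := by
      rw [Complex.real_smul]
      push_cast
      rfl
    rw [h5, ← h4, VectorFourier.fourierIntegral]
    refine integral_congr_ae (Eventually.of_forall fun ξ => ?_)
    simp only [LinearMap.flip_apply, LinearMap.neg_apply, innerₗ_apply_apply, neg_neg, smul_smul]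
    rw [← AddChar.map_add_eq_mul]
    congr 2
    rw [inner_smul_left, inner_smul_right, inner_sub_right, real_inner_comm x ξ]
    simp [hl.ne']
    ring
  simp only [h2, h3] at h1
  rw [SchwartzMap.fourier_coe, Real.fourier_eq]
  simp only [smul_eq_mul] at h1
  rw [← h1]
  refine integral_congr_ae (Eventually.of_forall fun ξ => ?_)
  simp only [SchwartzMap.smulLeftCLM_apply_apply (hasTemperateGrowth_dilate χ l⁻¹), smul_eq_mul,
    Circle.smul_def]
  ring

variable {p : ℝ≥0∞} [Fact (1 ≤ p)]

theorem memLp_bandConv (hp : p ≠ ⊤) (φ : 𝓢(EuclideanSpace ℝ (Fin d), ℂ)) {l : ℝ} (hl : 0 < l)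
    {T : EuclideanSpace ℝ (Fin d) → ℂ} (hTm : Measurable T) (hT : MemLp T p) :
    MemLp (bandConv φ l T) p := by
  have h1p : 1 ≤ p := Fact.out
  have hp0 : p ≠ 0 := (zero_lt_one.trans_le h1p).ne'
  have hq : 1 ≤ p.toReal := by simpa using ENNReal.toReal_mono hp h1p
  obtain ⟨C, -, hC, -⟩ := exists_kernel_bound φ (d + 2) 0
  refine ⟨(measurable_bandConv l hTm).aestronglyMeasurable, ?_⟩
  refine (eLpNorm_le_of_enorm_le_average hp0 hp (enorm_bandConv_le hl hC) ENNReal.ofReal_ne_top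
    (lintegral_average_rpow_volume_le hl (by fun_prop) hq)).trans_lt ?_
  refine ENNReal.mul_lt_top (ENNReal.mul_lt_top ENNReal.ofReal_lt_top ?_) hT.2
  exact ENNReal.rpow_lt_top_of_nonneg (by positivity)
    (ENNReal.rpow_ne_top_of_nonneg (by positivity) (decayMass_lt_top (by omega)).ne)

/-- Provides the absolute integrability for Fubini. Jensen with weight |u| reduces the claim to
finiteness of ∫ |u| A^p, where u is bounded and the average A is in L^p. -/
theorem lintegral_mul_average_lt_top (hp : p ≠ ⊤) (u : 𝓢(EuclideanSpace ℝ (Fin d), ℂ)) {l : ℝ}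
    (hl : 0 < l) {T : EuclideanSpace ℝ (Fin d) → ℂ} (hTm : Measurable T) (hT : MemLp T p) :
    ∫⁻ x, ‖u x‖ₑ * average l (fun z => ‖T z‖ₑ) x < ⊤ := by
  have h1p : 1 ≤ p := Fact.out
  have hp0 : p ≠ 0 := (zero_lt_one.trans_le h1p).ne'
  have hq : 1 ≤ p.toReal := by simpa using ENNReal.toReal_mono hp h1p
  have hA : ∫⁻ x, average l (fun z => ‖T z‖ₑ) x ^ p.toReal < ⊤ := by
    refine (lintegral_average_rpow_volume_le hl (by fun_prop) hq).trans_lt ?_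
    refine ENNReal.mul_lt_top
      (ENNReal.rpow_lt_top_of_nonneg (by positivity) (decayMass_lt_top (by omega)).ne) ?_
    exact lintegral_rpow_enorm_lt_top_of_eLpNorm_lt_top hp0 hp hT.2
  have hAm : Measurable (average l (fun z => ‖T z‖ₑ)) := measurable_average l (by fun_prop)
  have hum : Measurable fun x => ‖u x‖ₑ := u.continuous.measurable.enorm
  have hu1 : ∫⁻ x, ‖u x‖ₑ < ⊤ := u.integrable.hasFiniteIntegral
  have hle := lintegral_mul_rpow_le (μ := volume) hum hAm hq
  have hb : ∃ B : ℝ≥0∞, B < ⊤ ∧ ∀ x, ‖u x‖ₑ ≤ B :=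
    ⟨ENNReal.ofReal (SchwartzMap.seminorm ℝ 0 0 u), ENNReal.ofReal_lt_top, fun x => by
      rw [← ofReal_norm]
      exact ENNReal.ofReal_le_ofReal (SchwartzMap.norm_le_seminorm ℝ u x)⟩
  obtain ⟨B, hB, hub⟩ := hb
  have h3 : ∫⁻ x, ‖u x‖ₑ * average l (fun z => ‖T z‖ₑ) x ^ p.toReal < ⊤ := by
    refine (lintegral_mono fun x => mul_le_mul_left (hub x) _).trans_lt ?_
    rw [lintegral_const_mul' _ _ hB.ne]
    exact ENNReal.mul_lt_top hB hA
  have h4 := hle.trans_lt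
    (ENNReal.mul_lt_top (ENNReal.rpow_lt_top_of_nonneg (by linarith) hu1.ne) h3)
  exact (ENNReal.rpow_lt_top_iff_of_pos (by linarith)).1 h4

theorem integral_mul_bandConv (hp : p ≠ ⊤) (φ u : 𝓢(EuclideanSpace ℝ (Fin d), ℂ)) {l : ℝ}
    (hl : 0 < l) {T : EuclideanSpace ℝ (Fin d) → ℂ} (hTm : Measurable T) (hT : MemLp T p) :
    ∫ x, u x * bandConv φ l T x = ∫ y, (∫ x, u x * ((l : ℂ) ^ d * φ (l • (x - y)))) * T y := by
  obtain ⟨C, -, hC, -⟩ := exists_kernel_bound φ (d + 2) 0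
  have hφm : Measurable φ := φ.continuous.measurable
  have hum : Measurable u := u.continuous.measurable
  have hm : Measurable (Function.uncurry fun x y : EuclideanSpace ℝ (Fin d) =>
      u x * ((l : ℂ) ^ d * φ (l • (x - y)) * T y)) := by
    unfold Function.uncurry
    fun_prop
  have hint : Integrable (Function.uncurry fun x y : EuclideanSpace ℝ (Fin d) =>
      u x * ((l : ℂ) ^ d * φ (l • (x - y)) * T y)) (volume.prod volume) := by
    refine ⟨hm.aestronglyMeasurable, ?_⟩
    rw [hasFiniteIntegral_iff_enorm, lintegral_prod _ hm.enorm.aemeasurable]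
    have hle : ∀ x, ∫⁻ y, ‖u x * ((l : ℂ) ^ d * φ (l • (x - y)) * T y)‖ₑ ≤
        ENNReal.ofReal C * (‖u x‖ₑ * average l (fun z => ‖T z‖ₑ) x) := by
      intro x
      simp_rw [enorm_mul (u x)]
      rw [lintegral_const_mul' _ _ enorm_ne_top, mul_left_comm]
      exact mul_le_mul_right (lintegral_enorm_kernel_mul_le hl hC x) _
    refine (lintegral_mono hle).trans_lt ?_
    rw [lintegral_const_mul' _ _ ENNReal.ofReal_ne_top]
    exact ENNReal.mul_lt_top ENNReal.ofReal_lt_top (lintegral_mul_average_lt_top hp u hl hTm hT)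
  calc ∫ x, u x * bandConv φ l T x
      = ∫ x, ∫ y, u x * ((l : ℂ) ^ d * φ (l • (x - y)) * T y) := by
        simp only [integral_const_mul, bandConv]
    _ = ∫ y, ∫ x, u x * ((l : ℂ) ^ d * φ (l • (x - y)) * T y) := integral_integral_swap hint
    _ = _ := by
        simp only [← integral_mul_const, mul_assoc]

theorem toTemperedDistribution_injective : Function.Injective
    (Lp.toTemperedDistribution (E := EuclideanSpace ℝ (Fin d)) (F := ℂ) (μ := volume) (p := p)) :=
  LinearMap.ker_eq_bot.1 (Lp.ker_toTemperedDistributionCLM_eq_bot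
    (F := ℂ) (μ := (volume : Measure (EuclideanSpace ℝ (Fin d)))) (p := p))

/-- A function in `L^p` that is fixed by the Fourier multiplier `χ (l⁻¹ ·)` is reproduced by the
convolution with the corresponding kernel. -/
theorem bandConv_ae_eq_of_multiplier (hp : p ≠ ⊤) (χ : 𝓢(EuclideanSpace ℝ (Fin d), ℂ)) {l : ℝ}
    (hl : 0 < l) (T : Lp ℂ p (volume : Measure (EuclideanSpace ℝ (Fin d))))
    (hT : TemperedDistribution.fourierMultiplierCLM ℂ (fun ξ => χ (l⁻¹ • ξ))
      (T : 𝓢'(EuclideanSpace ℝ (Fin d), ℂ)) = (T : 𝓢'(EuclideanSpace ℝ (Fin d), ℂ))) :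
    bandConv (𝓕⁻ χ) l T =ᵐ[volume] T := by
  have hTm : Measurable T := (Lp.stronglyMeasurable T).measurable
  have hB := memLp_bandConv hp (𝓕⁻ χ) hl hTm (Lp.memLp T)
  suffices h : hB.toLp = T from hB.coeFn_toLp.symm.trans (by rw [h])
  refine toTemperedDistribution_injective ?_
  rw [← hT]
  ext u
  rw [TemperedDistribution.fourierMultiplierCLM_apply_apply, Lp.toTemperedDistribution_apply,
    Lp.toTemperedDistribution_apply]
  simp only [fourier_smul_fourierInv_apply χ u hl, smul_eq_mul]
  rw [← integral_mul_bandConv hp (𝓕⁻ χ) u hl hTm (Lp.memLp T)]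
  refine integral_congr_ae (hB.coeFn_toLp.mono fun x hx => ?_)
  simp only [hx]

end Multiplier

/-! ### Low-pass filters converge to the identity -/

section Cutoff

variable {d : ℕ}

/-- A smooth function equal to `1` on the unit ball and supported in the ball of radius `2`. -/
def lowPass (d : ℕ) : 𝓢(EuclideanSpace ℝ (Fin d), ℂ) :=
  HasCompactSupport.toSchwartzMap
    (f := Complex.ofRealCLM ∘ (⟨1, 2, one_pos, one_lt_two⟩ : ContDiffBump (0 : EuclideanSpace ℝ (Fin d))))
    ((ContDiffBump.hasCompactSupport _).comp_left rfl)
    (Complex.ofRealCLM.contDiff.comp (ContDiffBump.contDiff _))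

theorem lowPass_eq_one {x : EuclideanSpace ℝ (Fin d)} (hx : ‖x‖ ≤ 1) : lowPass d x = 1 := by
  have : (⟨1, 2, one_pos, one_lt_two⟩ : ContDiffBump (0 : EuclideanSpace ℝ (Fin d))) x = 1 :=
    ContDiffBump.one_of_mem_closedBall _ (by simpa using hx)
  simp [lowPass, this]

theorem lowPass_eq_zero {x : EuclideanSpace ℝ (Fin d)} (hx : 2 ≤ ‖x‖) : lowPass d x = 0 := by
  have : (⟨1, 2, one_pos, one_lt_two⟩ : ContDiffBump (0 : EuclideanSpace ℝ (Fin d))) x = 0 :=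
    ContDiffBump.zero_of_le_dist _ (by simpa using hx)
  simp [lowPass, this]

/-- A dilation by c ≤ 1 does not increase the derivatives, hence a bound uniform in c. -/
theorem exists_iteratedFDeriv_sub_one_bound (χ : 𝓢(EuclideanSpace ℝ (Fin d), ℂ)) (i : ℕ) :
    ∃ B : ℝ, 0 ≤ B ∧ ∀ c : ℝ, 0 ≤ c → c ≤ 1 → ∀ x,
      ‖iteratedFDeriv ℝ i (fun x => χ (c • x) - 1) x‖ ≤ B := by
  have hχ : ContDiff ℝ i χ := χ.smooth i
  have hc1 : ContDiff ℝ i (fun x => χ x - 1) := hχ.sub contDiff_const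
  obtain ⟨B, hB, hle⟩ : ∃ B : ℝ, 0 ≤ B ∧ ∀ x, ‖iteratedFDeriv ℝ i (fun x => χ x - 1) x‖ ≤ B := by
    refine ⟨SchwartzMap.seminorm ℝ 0 i χ + 1, by positivity, fun x => ?_⟩
    have h1 : iteratedFDeriv ℝ i (fun x => χ x - 1) x =
        iteratedFDeriv ℝ i χ x + iteratedFDeriv ℝ i (fun _ => (-1 : ℂ)) x := by
      simp_rw [sub_eq_add_neg]
      exact iteratedFDeriv_add_apply hχ.contDiffAt contDiff_const.contDiffAt
    rw [h1]
    refine (norm_add_le _ _).trans (add_le_add (χ.norm_iteratedFDeriv_le_seminorm ℝ i x) ?_)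
    rcases Nat.eq_zero_or_pos i with rfl | hi
    · simp
    · rw [iteratedFDeriv_const_of_ne hi.ne']
      simp
  refine ⟨B, hB, fun c hc0 hc x => ?_⟩
  have h2 := (c • ContinuousLinearMap.id ℝ (EuclideanSpace ℝ (Fin d))).iteratedFDeriv_comp_right
    hc1 x (i := i) le_rfl
  have h3 : (fun x => χ (c • x) - 1) = (fun x => χ x - 1) ∘
      (c • ContinuousLinearMap.id ℝ (EuclideanSpace ℝ (Fin d))) := by
    ext x
    simp
  rw [h3, h2]
  refine (ContinuousMultilinearMap.norm_compContinuousLinearMap_le _ _).trans ?_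
  have h4 : ‖c • ContinuousLinearMap.id ℝ (EuclideanSpace ℝ (Fin d))‖ ≤ 1 := by
    rw [norm_smul, Real.norm_of_nonneg hc0]
    exact mul_le_one₀ hc (norm_nonneg _) ContinuousLinearMap.norm_id_le
  refine (mul_le_mul (hle _) (Finset.prod_le_one (fun _ _ => norm_nonneg _) fun _ _ => h4)
    (Finset.prod_nonneg fun _ _ => norm_nonneg _) hB).trans_eq (mul_one B)

/-- With c = 2^{-L}, the difference (χ(c·) - 1)ψ vanishes for |x| < 1/c. For |x| ≥ 1/c one has |x|^k
≤ c|x|^{k+1}, so one extra power in the seminorms of ψ gains the factor c. -/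
theorem tendsto_smulLeftCLM_dilate (χ ψ : 𝓢(EuclideanSpace ℝ (Fin d), ℂ))
    (hχ : ∀ x, ‖x‖ ≤ 1 → χ x = 1) :
    Tendsto (fun L : ℕ => SchwartzMap.smulLeftCLM ℂ (fun ξ => χ (((2 : ℝ) ^ (L : ℤ))⁻¹ • ξ)) ψ) atTop
      (𝓝 ψ) := by
  rw [(schwartz_withSeminorms ℝ (EuclideanSpace ℝ (Fin d)) ℂ).tendsto_nhds]
  rintro ⟨k, n⟩ ε hε
  choose B hB hBle using exists_iteratedFDeriv_sub_one_bound χ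
  set M : ℝ := ∑ i ∈ Finset.range (n + 1),
    (n.choose i : ℝ) * B i * SchwartzMap.seminorm ℝ (k + 1) (n - i) ψ with hM
  have hM0 : 0 ≤ M := Finset.sum_nonneg fun i _ => by have := hB i; positivity
  have key : ∀ L : ℕ, SchwartzMap.seminorm ℝ k n
      (SchwartzMap.smulLeftCLM ℂ (fun ξ => χ (((2 : ℝ) ^ (L : ℤ))⁻¹ • ξ)) ψ - ψ) ≤
        (1 / 2 : ℝ) ^ L * M := by
    intro L
    set c : ℝ := ((2 : ℝ) ^ (L : ℤ))⁻¹ with hc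
    have hc0 : 0 < c := by positivity
    have hc' : c = (1 / 2 : ℝ) ^ L := by rw [hc, zpow_natCast, one_div, inv_pow]
    have hc1 : c ≤ 1 := by rw [hc']; exact pow_le_one₀ (by norm_num) (by norm_num)
    rw [← hc']
    refine SchwartzMap.seminorm_le_bound ℝ k n _ (by positivity) fun x => ?_
    have hcoe : (⇑(SchwartzMap.smulLeftCLM ℂ (fun ξ => χ (c • ξ)) ψ - ψ) :
        EuclideanSpace ℝ (Fin d) → ℂ) = fun x => (χ (c • x) - 1) * ψ x := by
      ext x
      rw [sub_apply,
        SchwartzMap.smulLeftCLM_apply_apply (hasTemperateGrowth_dilate χ c), smul_eq_mul]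
      ring
    rw [hcoe]
    rcases lt_or_ge ‖x‖ c⁻¹ with hx | hx
    · have hev : (fun x => (χ (c • x) - 1) * ψ x) =ᶠ[𝓝 x] fun _ => 0 := by
        filter_upwards [(isOpen_lt continuous_norm continuous_const).mem_nhds hx] with y hy
        have : ‖c • y‖ ≤ 1 := by
          rw [norm_smul, Real.norm_of_nonneg hc0.le]
          have hy' : ‖y‖ < c⁻¹ := hy
          calc c * ‖y‖ ≤ c * c⁻¹ := by gcongr
            _ = 1 := mul_inv_cancel₀ hc0.ne'
        rw [hχ _ this]
        ring
      rw [(Filter.EventuallyEq.iteratedFDeriv ℝ hev n).eq_of_nhds]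
      have : iteratedFDeriv ℝ n (fun _ : EuclideanSpace ℝ (Fin d) => (0 : ℂ)) x = 0 := by
        simp
      rw [this, norm_zero, mul_zero]
      positivity
    · have hsm : ContDiff ℝ n fun x => χ (c • x) - 1 :=
        ((χ.smooth n).comp (contDiff_const_smul c)).sub contDiff_const
      have h1 := norm_iteratedFDeriv_mul_le hsm (ψ.smooth n) x (n := n) le_rfl
      have hxk : ‖x‖ ^ k ≤ c * ‖x‖ ^ (k + 1) := by
        rw [pow_succ, ← mul_assoc, mul_comm c, mul_assoc]
        refine le_mul_of_one_le_right (by positivity) ?_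
        calc (1 : ℝ) = c * c⁻¹ := (mul_inv_cancel₀ hc0.ne').symm
          _ ≤ c * ‖x‖ := by gcongr
      calc ‖x‖ ^ k * ‖iteratedFDeriv ℝ n (fun x => (χ (c • x) - 1) * ψ x) x‖
          ≤ (c * ‖x‖ ^ (k + 1)) * ∑ i ∈ Finset.range (n + 1), (n.choose i : ℝ) *
              ‖iteratedFDeriv ℝ i (fun x => χ (c • x) - 1) x‖ *
                ‖iteratedFDeriv ℝ (n - i) ψ x‖ := by gcongr
        _ = c * ∑ i ∈ Finset.range (n + 1), (n.choose i : ℝ) *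
              ‖iteratedFDeriv ℝ i (fun x => χ (c • x) - 1) x‖ *
                (‖x‖ ^ (k + 1) * ‖iteratedFDeriv ℝ (n - i) ψ x‖) := by
            rw [mul_assoc, Finset.mul_sum]
            congr 1
            refine Finset.sum_congr rfl fun i _ => ?_
            ring
        _ ≤ c * M := by
            refine mul_le_mul_of_nonneg_left (Finset.sum_le_sum fun i _ => ?_) hc0.le
            have h2 := hBle i c hc0.le hc1 x
            have h3 := SchwartzMap.le_seminorm ℝ (k + 1) (n - i) ψ x
            have h4 := hB i
            gcongr
  have hlim : Tendsto (fun L : ℕ => (1 / 2 : ℝ) ^ L * M) atTop (𝓝 0) := by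
    simpa using (tendsto_pow_atTop_nhds_zero_of_lt_one (by norm_num : (0 : ℝ) ≤ 1 / 2)
      (by norm_num)).mul_const M
  filter_upwards [hlim.eventually_lt_const hε] with L hL
  exact (key L).trans_lt hL

/-- A tempered distribution annihilated by all low-pass filters vanishes. -/
theorem eq_zero_of_lowPass_eq_zero (U : 𝓢'(EuclideanSpace ℝ (Fin d), ℂ))
    (hU : ∀ L : ℕ, TemperedDistribution.fourierMultiplierCLM ℂ
      (fun ξ => lowPass d (((2 : ℝ) ^ (L : ℤ))⁻¹ • ξ)) U = 0) : U = 0 := by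
  ext u
  have h1 := tendsto_smulLeftCLM_dilate (lowPass d) (𝓕⁻ u) fun x hx => lowPass_eq_one hx
  have h2 : Continuous fun ψ : 𝓢(EuclideanSpace ℝ (Fin d), ℂ) => U (𝓕 ψ) :=
    (map_continuous U).comp continuous_fourier
  have h3 := (h2.tendsto _).comp h1
  have h4 : ∀ L : ℕ, U (𝓕 (SchwartzMap.smulLeftCLM ℂ
      (fun ξ => lowPass d (((2 : ℝ) ^ (L : ℤ))⁻¹ • ξ)) (𝓕⁻ u))) = 0 := by
    intro L
    rw [← TemperedDistribution.fourierMultiplierCLM_apply_apply, hU L]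
    rfl
  simp only [Function.comp_def, h4, FourierTransform.fourier_fourierInv_eq] at h3
  exact (tendsto_nhds_unique h3 tendsto_const_nhds)

end Cutoff

/-! ### Littlewood–Paley decomposition -/

section Decomposition

variable {d : ℕ} {ρ : EuclideanSpace ℝ (Fin d) → ℝ} {p : ℝ≥0∞} [Fact (1 ≤ p)]

theorem IsDyadicPartition.hasTemperateGrowth (hρ : IsDyadicPartition ρ) (j : ℤ) :
    (fun ξ => ((ρ ((2 : ℝ) ^ (-j) • ξ) : ℝ) : ℂ)).HasTemperateGrowth := by
  have hcs : HasCompactSupport ρ := by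
    refine HasCompactSupport.of_support_subset_isCompact (isCompact_closedBall 0 2)
      (hρ.support_subset.trans fun y hy => ?_)
    simpa using hy.2.le
  have hcs' : HasCompactSupport (Complex.ofRealCLM ∘ ρ) := hcs.comp_left rfl
  exact hasTemperateGrowth_dilate
    (hcs'.toSchwartzMap (Complex.ofRealCLM.contDiff.comp hρ.smooth)) _

theorem IsDyadicPartition.eq_zero_of_norm_le (hρ : IsDyadicPartition ρ) {j : ℤ}
    {ξ : EuclideanSpace ℝ (Fin d)} (h : ‖ξ‖ ≤ (2 : ℝ) ^ (j - 1)) : ρ ((2 : ℝ) ^ (-j) • ξ) = 0 := by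
  by_contra h0
  have h1 := (hρ.support_subset h0).1
  rw [norm_smul, Real.norm_of_nonneg (by positivity)] at h1
  have h2 : (2 : ℝ) ^ (-j) * ‖ξ‖ ≤ (2 : ℝ) ^ (-j) * (2 : ℝ) ^ (j - 1) := by gcongr
  rw [← zpow_add₀ two_ne_zero, show -j + (j - 1) = -1 by ring, zpow_neg_one] at h2
  linarith

theorem IsDyadicPartition.eq_zero_of_le_norm (hρ : IsDyadicPartition ρ) {j : ℤ}
    {ξ : EuclideanSpace ℝ (Fin d)} (h : (2 : ℝ) ^ (j + 1) ≤ ‖ξ‖) : ρ ((2 : ℝ) ^ (-j) • ξ) = 0 := by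
  by_contra h0
  have h1 := (hρ.support_subset h0).2
  rw [norm_smul, Real.norm_of_nonneg (by positivity)] at h1
  have h2 : (2 : ℝ) ^ (-j) * (2 : ℝ) ^ (j + 1) ≤ (2 : ℝ) ^ (-j) * ‖ξ‖ := by gcongr
  rw [← zpow_add₀ two_ne_zero, show -j + (j + 1) = 1 by ring, zpow_one] at h2
  linarith

/-- The infimum is attained because `L^p` embeds injectively into tempered distributions, so at most
one function competes. -/
theorem exists_of_distLpNorm_lt_top {u : 𝓢'(EuclideanSpace ℝ (Fin d), ℂ)}
    (hu : distLpNorm p u < ⊤) :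
    ∃ g : Lp ℂ p (volume : Measure (EuclideanSpace ℝ (Fin d))),
      (g : 𝓢'(EuclideanSpace ℝ (Fin d), ℂ)) = u ∧ ‖g‖ₑ = distLpNorm p u := by
  simp only [distLpNorm, iInf_lt_iff] at hu
  obtain ⟨g, hg, -⟩ := hu
  refine ⟨g, hg, le_antisymm ?_ ?_⟩
  · refine le_iInf₂ fun g' hg' => ?_
    rw [toTemperedDistribution_injective (hg'.trans hg.symm)]
  · exact iInf₂_le g hg

/-- If `M` is a multiplier supported in an annulus on which finitely many of the functions
`ρ (2^{-j} ·)`, `j ≥ j₀`, sum to one, then it annihilates the difference of `f` and its high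
frequency part. -/
theorem multiplier_sub_tsum_eq_zero (hρ : IsDyadicPartition ρ)
    (f : Lp ℂ p (volume : Measure (EuclideanSpace ℝ (Fin d)))) {j₀ : ℤ}
    {g : ℕ → Lp ℂ p (volume : Measure (EuclideanSpace ℝ (Fin d)))}
    (hg : ∀ n : ℕ, (g n : 𝓢'(EuclideanSpace ℝ (Fin d), ℂ)) = dyadicBlock ρ (j₀ + n) f)
    (hsum : Summable g) {w : EuclideanSpace ℝ (Fin d) → ℂ} (hw : w.HasTemperateGrowth) {L : ℕ}
    (hw0 : ∀ ξ, w ξ ≠ 0 → (2 : ℝ) ^ j₀ < ‖ξ‖ ∧ ‖ξ‖ < 2 ^ (L + 1)) :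
    TemperedDistribution.fourierMultiplierCLM ℂ w
      ((f - ∑' n, g n : Lp ℂ p (volume : Measure (EuclideanSpace ℝ (Fin d)))) :
        𝓢'(EuclideanSpace ℝ (Fin d), ℂ)) = 0 := by
  -- For n ≥ N one has j₀ + n - 1 ≥ L + 1, so block n lives beyond 2^{L+1} and misses the support of
  -- w.
  set N : ℕ := (L + 2 - j₀).toNat with hN
  have hNle : ((L : ℤ) + 2 - j₀) ≤ N := Int.self_le_toNat _
  set r : ℕ → EuclideanSpace ℝ (Fin d) → ℂ :=
    fun n ξ => ((ρ ((2 : ℝ) ^ (-(j₀ + n)) • ξ) : ℝ) : ℂ) with hr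
  have hrg : ∀ n, (r n).HasTemperateGrowth := fun n => hρ.hasTemperateGrowth _
  have hhigh : ∀ n, N ≤ n → r n * w = 0 := by
    intro n hn
    ext ξ
    by_cases h : w ξ = 0
    · simp [h]
    · have h1 := (hw0 ξ h).2
      have : ρ ((2 : ℝ) ^ (-(j₀ + n)) • ξ) = 0 := by
        refine hρ.eq_zero_of_norm_le (h1.le.trans ?_)
        rw [← zpow_natCast]
        refine zpow_le_zpow_right₀ one_le_two ?_
        push_cast
        omega
      change ((ρ ((2 : ℝ) ^ (-(j₀ + n)) • ξ) : ℝ) : ℂ) * w ξ = 0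
      rw [this, Complex.ofReal_zero, zero_mul]
  have hone : (∑ n ∈ Finset.range N, r n * w) = w := by
    rw [← Finset.sum_mul]
    ext ξ
    by_cases h : w ξ = 0
    · simp [h]
    · obtain ⟨h1, h2⟩ := hw0 ξ h
      have hξ : ξ ≠ 0 := by
        rintro rfl
        rw [norm_zero] at h1
        exact absurd h1 (not_lt.2 (by positivity))
      have h3 := hρ.hasSum_one ξ hξ
      -- Indices below j₀ contribute nothing at ξ, since |ξ| > 2^{j₀}.
      have h4 : HasSum (fun n : ℕ => ρ ((2 : ℝ) ^ (-(j₀ + n)) • ξ)) 1 := by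
        have hinj : Function.Injective fun n : ℕ => j₀ + (n : ℤ) := fun a b hab => by
          simpa using hab
        refine (hinj.hasSum_iff (f := fun j : ℤ => ρ ((2 : ℝ) ^ (-j) • ξ)) fun j hj => ?_).2 h3
        have hjj : j < j₀ := by
          by_contra hcon
          exact hj ⟨(j - j₀).toNat, by simp only; omega⟩
        exact hρ.eq_zero_of_le_norm (le_trans (zpow_le_zpow_right₀ one_le_two (by omega)) h1.le)
      have h5 : HasSum (fun n : ℕ => ρ ((2 : ℝ) ^ (-(j₀ + n)) • ξ))
          (∑ n ∈ Finset.range N, ρ ((2 : ℝ) ^ (-(j₀ + n)) • ξ)) := by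
        refine hasSum_sum_of_ne_finset_zero fun n hn => ?_
        have h6 := congrFun (hhigh n (by simpa using hn)) ξ
        simpa [hr, h] using h6
      have h6 := h5.unique h4
      have h7 : (∑ n ∈ Finset.range N, r n) ξ = 1 := by
        rw [Finset.sum_apply]
        simp only [hr]
        rw [← Complex.ofReal_sum, h6, Complex.ofReal_one]
      rw [Pi.mul_apply, h7, one_mul]
  ext u
  -- A continuous functional on L^p, so it passes through the series ∑ gₙ, which converges there.
  set Λ : Lp ℂ p (volume : Measure (EuclideanSpace ℝ (Fin d))) →L[ℂ] ℂ :=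
    (PointwiseConvergenceCLM.evalCLM _ ℂ u) ∘L
      (TemperedDistribution.fourierMultiplierCLM ℂ w) ∘L
        Lp.toTemperedDistributionCLM ℂ volume p with hΛ
  change Λ (f - ∑' n, g n) = 0
  have hΛg : ∀ n, Λ (g n) = TemperedDistribution.fourierMultiplierCLM ℂ (r n * w)
      (f : 𝓢'(EuclideanSpace ℝ (Fin d), ℂ)) u := by
    intro n
    change TemperedDistribution.fourierMultiplierCLM ℂ w
      (g n : 𝓢'(EuclideanSpace ℝ (Fin d), ℂ)) u = _
    rw [hg n, dyadicBlock,
      TemperedDistribution.fourierMultiplierCLM_fourierMultiplierCLM_apply (hrg n) hw]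
  have hz : TemperedDistribution.fourierMultiplierCLM ℂ (0 : EuclideanSpace ℝ (Fin d) → ℂ) = 0 := by
    have := TemperedDistribution.fourierMultiplierCLM_const (E := EuclideanSpace ℝ (Fin d))
      (F := ℂ) 0
    rw [zero_smul] at this
    exact this
  have hsumΛ : ∑' n, Λ (g n) = ∑ n ∈ Finset.range N, Λ (g n) := by
    refine tsum_eq_sum fun n hn => ?_
    rw [hΛg, hhigh n (by simpa using hn), hz]
    rfl
  rw [map_sub, Λ.map_tsum hsum, hsumΛ, sub_eq_zero]
  calc Λ f = TemperedDistribution.fourierMultiplierCLM ℂ (∑ n ∈ Finset.range N, r n * w)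
        (f : 𝓢'(EuclideanSpace ℝ (Fin d), ℂ)) u := by
        rw [hone]
        rfl
    _ = ∑ n ∈ Finset.range N, Λ (g n) := by
        have h8 := TemperedDistribution.fourierMultiplierCLM_sum ℂ (s := Finset.range N)
          (g := fun n => r n * w) fun n _ => (hrg n).mul hw
        have h9 : (fun x => ∑ n ∈ Finset.range N, (r n * w) x) = ∑ n ∈ Finset.range N, r n * w := by
          ext x
          rw [Finset.sum_apply]
        rw [h9] at h8
        rw [h8, Finset.sum_congr rfl fun n _ => hΛg n]
        simp

/-- The reproducing kernel of functions with spectrum in the unit ball. -/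
def bandKernel (d : ℕ) : 𝓢(EuclideanSpace ℝ (Fin d), ℂ) := 𝓕⁻ (lowPass d)

/-- Block j has spectrum in |ξ| < 2^{j+1}, where the low-pass filter at scale 2^{j+1} equals one. -/
theorem bandConv_dyadicBlock (hp : p ≠ ⊤) (hρ : IsDyadicPartition ρ)
    (u : 𝓢'(EuclideanSpace ℝ (Fin d), ℂ)) {j : ℤ}
    {g : Lp ℂ p (volume : Measure (EuclideanSpace ℝ (Fin d)))}
    (hg : (g : 𝓢'(EuclideanSpace ℝ (Fin d), ℂ)) = dyadicBlock ρ j u) :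
    bandConv (bandKernel d) ((2 : ℝ) ^ (j + 1)) g =ᵐ[volume] g := by
  refine bandConv_ae_eq_of_multiplier hp (lowPass d) (by positivity) g ?_
  rw [hg, dyadicBlock, TemperedDistribution.fourierMultiplierCLM_fourierMultiplierCLM_apply
    (hρ.hasTemperateGrowth j) (hasTemperateGrowth_dilate _ _)]
  congr 2 with ξ
  rw [Pi.mul_apply]
  by_cases h : ‖ξ‖ ≤ (2 : ℝ) ^ (j + 1)
  · rw [lowPass_eq_one, mul_one]
    rw [norm_smul, Real.norm_of_nonneg (by positivity), inv_mul_le_iff₀ (by positivity), mul_one]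
    exact h
  · rw [hρ.eq_zero_of_le_norm (not_le.1 h).le, Complex.ofReal_zero, zero_mul]

theorem fourierMultiplierCLM_sub {w₁ w₂ : EuclideanSpace ℝ (Fin d) → ℂ}
    (h₁ : w₁.HasTemperateGrowth) (h₂ : w₂.HasTemperateGrowth) :
    TemperedDistribution.fourierMultiplierCLM ℂ (fun ξ => w₁ ξ - w₂ ξ) =
      TemperedDistribution.fourierMultiplierCLM ℂ w₁ -
        TemperedDistribution.fourierMultiplierCLM ℂ w₂ := by
  have h := SchwartzMap.smulLeftCLM_sub (F := ℂ) h₁ h₂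
  ext v u
  change v (𝓕 (SchwartzMap.smulLeftCLM ℂ (w₁ - w₂) (𝓕⁻ u))) =
    v (𝓕 (SchwartzMap.smulLeftCLM ℂ w₁ (𝓕⁻ u))) - v (𝓕 (SchwartzMap.smulLeftCLM ℂ w₂ (𝓕⁻ u)))
  rw [h, sub_apply]
  exact (congrArg v (map_sub (fourierCLM ℂ 𝓢(EuclideanSpace ℝ (Fin d), ℂ)) _ _)).trans
    (map_sub v _ _)

/-- Inhomogeneous Littlewood–Paley decomposition into functions reproduced by `bandConv`. -/
theorem exists_decomposition (hp : p ≠ ⊤) (hρ : IsDyadicPartition ρ) {s : ℝ} (hs : 0 < s)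
    (f : Lp ℂ p (volume : Measure (EuclideanSpace ℝ (Fin d)))) (hf : MemBesov ρ s p f) (j₀ : ℤ) :
    ∃ (a : Lp ℂ p (volume : Measure (EuclideanSpace ℝ (Fin d))))
      (g : ℕ → Lp ℂ p (volume : Measure (EuclideanSpace ℝ (Fin d)))),
      bandConv (bandKernel d) ((2 : ℝ) ^ j₀) a =ᵐ[volume] a ∧
      (∀ n : ℕ, bandConv (bandKernel d) ((2 : ℝ) ^ (j₀ + n + 1)) (g n) =ᵐ[volume] g n) ∧
      ∑' n : ℕ, ENNReal.ofReal (((2 : ℝ) ^ (j₀ + n)) ^ s) * ‖g n‖ₑ ≤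
        homBesovNorm ρ s p (f : 𝓢'(EuclideanSpace ℝ (Fin d), ℂ)) ∧
      ∑' n, ‖g n‖ₑ ≠ ⊤ ∧ a = f - ∑' n, g n := by
  have hterm : ∀ j : ℤ, distLpNorm p (dyadicBlock ρ j f) < ⊤ := by
    intro j
    have h1 : ENNReal.ofReal ((2 : ℝ) ^ ((j : ℝ) * s)) * distLpNorm p (dyadicBlock ρ j f) < ⊤ :=
      (ENNReal.le_tsum j).trans_lt hf
    have h2 : ENNReal.ofReal ((2 : ℝ) ^ ((j : ℝ) * s)) ≠ 0 := by
      rw [ne_eq, ENNReal.ofReal_eq_zero, not_le]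
      positivity
    exact (ENNReal.lt_top_of_mul_ne_top_right h1.ne h2)
  choose G hG hGn using fun j => exists_of_distLpNorm_lt_top (hterm j)
  set g : ℕ → Lp ℂ p (volume : Measure (EuclideanSpace ℝ (Fin d))) := fun n => G (j₀ + n) with hgdef
  have hle : ∑' n : ℕ, ENNReal.ofReal (((2 : ℝ) ^ (j₀ + n)) ^ s) * ‖g n‖ₑ ≤
      homBesovNorm ρ s p (f : 𝓢'(EuclideanSpace ℝ (Fin d), ℂ)) := by
    have hinj : Function.Injective fun n : ℕ => j₀ + (n : ℤ) := fun a b hab => by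
      simpa using hab
    refine le_trans (le_of_eq ?_) (ENNReal.tsum_comp_le_tsum_of_injective hinj _)
    refine tsum_congr fun n => ?_
    rw [hGn, ← Real.rpow_intCast, ← Real.rpow_mul zero_le_two]
  -- As s > 0, all Besov weights from j₀ on are at least the one at j₀.
  have hgsum : ∑' n, ‖g n‖ₑ ≠ ⊤ := by
    have hc : ENNReal.ofReal (((2 : ℝ) ^ j₀) ^ s) ≠ 0 := by
      rw [ne_eq, ENNReal.ofReal_eq_zero, not_le]
      positivity
    have h1 : ENNReal.ofReal (((2 : ℝ) ^ j₀) ^ s) * ∑' n, ‖g n‖ₑ < ⊤ := by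
      refine lt_of_le_of_lt ?_ (hle.trans_lt hf)
      rw [← ENNReal.tsum_mul_left]
      refine ENNReal.tsum_le_tsum fun n => ?_
      gcongr
      · exact one_le_two
      · omega
    exact (ENNReal.lt_top_of_mul_ne_top_right h1.ne hc).ne
  have hsummable : Summable g := Summable.of_enorm hgsum
  refine ⟨f - ∑' n, g n, g, ?_, fun n => bandConv_dyadicBlock hp hρ _ (hG _), hle, hgsum, rfl⟩
  refine bandConv_ae_eq_of_multiplier hp (lowPass d) (by positivity) _ ?_
  set a := f - ∑' n, g n with ha
  have hχ := hasTemperateGrowth_dilate (lowPass d)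
  rw [← sub_eq_zero]
  refine eq_zero_of_lowPass_eq_zero _ fun L => ?_
  -- To see that the filter χ at scale 2^{j₀} fixes a, test the difference against every low-pass
  -- filter. The combined symbol lives in the annulus 2^{j₀} < |ξ| < 2^{L+1}, where finitely many
  -- blocks already sum to one; the frequency origin never enters.
  have h1 : ∀ L : ℕ, TemperedDistribution.fourierMultiplierCLM ℂ
      (fun ξ => lowPass d (((2 : ℝ) ^ j₀)⁻¹ • ξ) * lowPass d (((2 : ℝ) ^ (L : ℤ))⁻¹ • ξ)
        - lowPass d (((2 : ℝ) ^ (L : ℤ))⁻¹ • ξ)) (a : 𝓢'(EuclideanSpace ℝ (Fin d), ℂ)) = 0 := by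
    intro L
    refine multiplier_sub_tsum_eq_zero hρ f (fun n => hG _) hsummable (L := L)
      (((hχ _).mul (hχ _)).sub (hχ _)) fun ξ hξ => ⟨?_, ?_⟩
    · by_contra hcon
      refine hξ ?_
      rw [lowPass_eq_one (x := ((2 : ℝ) ^ j₀)⁻¹ • ξ), one_mul, sub_self]
      rw [norm_smul, Real.norm_of_nonneg (by positivity), inv_mul_le_iff₀ (by positivity), mul_one]
      exact not_lt.1 hcon
    · by_contra hcon
      refine hξ ?_
      rw [lowPass_eq_zero (x := ((2 : ℝ) ^ (L : ℤ))⁻¹ • ξ), mul_zero, sub_self]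
      rw [norm_smul, Real.norm_of_nonneg (by positivity), ← div_eq_inv_mul,
        le_div_iff₀ (by positivity), zpow_natCast, ← pow_succ']
      exact not_lt.1 hcon
  have h2 := h1 L
  have hsub : TemperedDistribution.fourierMultiplierCLM ℂ
      (fun ξ => lowPass d (((2 : ℝ) ^ j₀)⁻¹ • ξ) * lowPass d (((2 : ℝ) ^ (L : ℤ))⁻¹ • ξ)
        - lowPass d (((2 : ℝ) ^ (L : ℤ))⁻¹ • ξ)) =
      TemperedDistribution.fourierMultiplierCLM ℂ ((fun ξ => lowPass d (((2 : ℝ) ^ j₀)⁻¹ • ξ)) *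
        (fun ξ => lowPass d (((2 : ℝ) ^ (L : ℤ))⁻¹ • ξ))) -
      TemperedDistribution.fourierMultiplierCLM ℂ
        (fun ξ => lowPass d (((2 : ℝ) ^ (L : ℤ))⁻¹ • ξ)) := by
    exact fourierMultiplierCLM_sub ((hχ _).mul (hχ _)) (hχ _)
  rw [hsub, sub_apply,
    ← TemperedDistribution.fourierMultiplierCLM_fourierMultiplierCLM_apply (hχ _) (hχ _),
    ← map_sub] at h2
  exact h2

end Decomposition

/-! ### Series of functions in L^p -/

section TsumLp

variable {α : Type*} [MeasurableSpace α] {μ : Measure α} {p : ℝ≥0∞} [Fact (1 ≤ p)]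
  {F : ℕ → α → ℂ}

theorem memLp_tsum_and_eLpNorm_tsum_le (hF : ∀ n, AEStronglyMeasurable (F n) μ)
    (hsum : ∑' n, eLpNorm (F n) p μ ≠ ⊤) :
    MemLp (fun x => ∑' n, F n x) p μ ∧
      eLpNorm (fun x => ∑' n, F n x) p μ ≤ ∑' n, eLpNorm (F n) p μ := by
  have hmem : ∀ n, MemLp (F n) p μ := fun n =>
    ⟨hF n, (ENNReal.le_tsum n).trans_lt hsum.lt_top⟩
  have hn : ∀ n, ‖(hmem n).toLp‖ₑ = eLpNorm (F n) p μ := fun n => Lp.enorm_toLp (hmem n)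
  have hsum' : ∑' n, ‖(hmem n).toLp‖ₑ ≠ ⊤ := by simpa only [hn] using hsum
  have hae : (fun x => ∑' n, F n x) =ᵐ[μ] (∑' n, (hmem n).toLp : Lp ℂ p μ) := by
    have h1 := ae_all_iff.2 fun n => (hmem n).coeFn_toLp
    filter_upwards [Lp.coeFn_tsum hsum', h1] with x hx hx1
    rw [hx]
    exact tsum_congr fun n => (hx1 n).symm
  refine ⟨(memLp_congr_ae hae).2 (Lp.memLp _), ?_⟩
  rw [eLpNorm_congr_ae hae, ← Lp.enorm_def]
  refine (enorm_tsum_le_tsum_enorm).trans_eq (tsum_congr hn)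

theorem ae_summable_of_tsum_eLpNorm (hF : ∀ n, AEStronglyMeasurable (F n) μ)
    (hsum : ∑' n, eLpNorm (F n) p μ ≠ ⊤) : ∀ᵐ x ∂μ, Summable fun n => F n x :=
  (summable_norm_of_tsum_eLpNorm_ne_top Fact.out hF hsum).mono fun _ hx => hx.of_norm

end TsumLp

/-! ### A single plane as a plane measure -/

section Slices

variable {k m d : ℕ}

theorem planeMeasure_singleton (h : k + m = d) (t : EuclideanSpace ℝ (Fin m)) :
    planeMeasure h {t} =
      (volume : Measure (EuclideanSpace ℝ (Fin k))).map fun y => joinCoords h y t := by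
  refine Measure.ext_of_lintegral _ fun u _ => ?_
  rw [lintegral_planeMeasure, (measurableEmbedding_joinCoords_left h t).lintegral_map,
    tsum_singleton t fun t => ∫⁻ y, u (joinCoords h y t)]

theorem eLpNorm_slice {p : ℝ≥0∞} (h : k + m = d) (g : EuclideanSpace ℝ (Fin d) → ℂ)
    (t : EuclideanSpace ℝ (Fin m)) :
    eLpNorm (fun y => g (joinCoords h y t)) p volume = eLpNorm g p (planeMeasure h {t}) := by
  rw [planeMeasure_singleton, (measurableEmbedding_joinCoords_left h t).eLpNorm_map_measure]
  rfl

end Slices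

/-! ### Upper sampling bound, traces and their continuity -/

section Traces

variable {k m d : ℕ} {p : ℝ≥0∞} [Fact (1 ≤ p)]

theorem one_le_toReal (hp : p ≠ ⊤) : 1 ≤ p.toReal := by
  have h1p : 1 ≤ p := Fact.out
  simpa using ENNReal.toReal_mono hp h1p

theorem exponent_ne_zero (p : ℝ≥0∞) [Fact (1 ≤ p)] : p ≠ 0 :=
  (zero_lt_one.trans_le (Fact.out : 1 ≤ p)).ne'

/-- Upper Plancherel–Pólya inequality on unions of planes. -/
theorem exists_sampling_bound (h : k + m = d) (hp : p ≠ ⊤)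
    (φ : 𝓢(EuclideanSpace ℝ (Fin d), ℂ)) :
    ∃ C : ℝ, 0 < C ∧ ∀ (l β : ℝ), 0 < l → 0 < β → l * β ≤ 1 →
      ∀ E : Set (EuclideanSpace ℝ (Fin m)), E.Countable → ∀ D : ℕ,
      (∀ y : EuclideanSpace ℝ (Fin m), {x ∈ E | y ∈ cube x β}.encard ≤ D) →
      ∀ T : EuclideanSpace ℝ (Fin d) → ℂ, Measurable T →
      eLpNorm (bandConv φ l T) p (planeMeasure h E) ≤
        ENNReal.ofReal C * (D : ℝ≥0∞) ^ (1 / p.toReal) *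
          ENNReal.ofReal ((β ^ ((m : ℝ) / p.toReal))⁻¹) * eLpNorm T p volume := by
  obtain ⟨C, hC0, hC, -⟩ := exists_kernel_bound φ (d + 2) 0
  have hq := one_le_toReal hp
  set S := samplingConst k m d p.toReal with hS
  have hSt : S < ⊤ := samplingConst_lt_top k m d hq
  refine ⟨C * ((S ^ (1 / p.toReal)).toReal + 1), by positivity, ?_⟩
  intro l β hl hβ hlβ E hE D hD T hT
  refine (eLpNorm_le_of_enorm_le_average (exponent_ne_zero p) hp (enorm_bandConv_le hl hC)
    ENNReal.ofReal_ne_top (lintegral_average_rpow_planeMeasure_le h hl hβ hlβ hE hD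
      (by fun_prop) hq)).trans (mul_le_mul_left ?_ _)
  have hS1 : S ^ (1 / p.toReal) ≤ ENNReal.ofReal ((S ^ (1 / p.toReal)).toReal + 1) := by
    rw [← ENNReal.ofReal_toReal (ENNReal.rpow_ne_top_of_nonneg (by positivity) hSt.ne)]
    refine ENNReal.ofReal_le_ofReal ?_
    rw [ENNReal.toReal_ofReal ENNReal.toReal_nonneg]
    linarith
  have hβ1 : ENNReal.ofReal ((2 * β) ^ m)⁻¹ ^ (1 / p.toReal) ≤
      ENNReal.ofReal ((β ^ ((m : ℝ) / p.toReal))⁻¹) := by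
    rw [ENNReal.ofReal_rpow_of_nonneg (by positivity) (by positivity)]
    refine ENNReal.ofReal_le_ofReal ?_
    rw [Real.inv_rpow (by positivity), ← Real.rpow_natCast, ← Real.rpow_mul (by positivity),
      mul_one_div]
    gcongr
    linarith
  rw [ENNReal.mul_rpow_of_nonneg _ _ (by positivity), ENNReal.mul_rpow_of_nonneg _ _ (by positivity),
    ENNReal.ofReal_mul hC0.le, mul_assoc, mul_assoc, mul_assoc]
  gcongr

theorem encard_singleton_inter_le (t y : EuclideanSpace ℝ (Fin m)) (b : ℝ) :
    {x ∈ ({t} : Set (EuclideanSpace ℝ (Fin m))) | y ∈ cube x b}.encard ≤ (1 : ℕ) := by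
  refine (Set.encard_le_encard (sep_subset _ _)).trans ?_
  simp

/-- Trace inequality for band-limited functions. -/
theorem exists_trace_bound (h : k + m = d) (hp : p ≠ ⊤) (φ : 𝓢(EuclideanSpace ℝ (Fin d), ℂ)) :
    ∃ C : ℝ, 0 < C ∧ ∀ l : ℝ, 0 < l → ∀ T : EuclideanSpace ℝ (Fin d) → ℂ, Measurable T →
      ∀ t : EuclideanSpace ℝ (Fin m),
      eLpNorm (fun y => bandConv φ l T (joinCoords h y t)) p volume ≤
        ENNReal.ofReal C * ENNReal.ofReal (l ^ ((m : ℝ) / p.toReal)) * eLpNorm T p volume := by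
  obtain ⟨C, hC, hb⟩ := exists_sampling_bound h hp φ
  refine ⟨C, hC, fun l hl T hT t => ?_⟩
  rw [eLpNorm_slice]
  -- A single plane: E = {t}, overlap D = 1, and the largest admissible half-side β = 1/l.
  have := hb l l⁻¹ hl (by positivity) (mul_inv_cancel₀ hl.ne').le {t} (countable_singleton t) 1
    (fun y => encard_singleton_inter_le t y _) T hT
  rwa [Nat.cast_one, ENNReal.one_rpow, mul_one, Real.inv_rpow hl.le, inv_inv] at this

/-- Moving from t₀ to t is translation in ℝ^d by (0, t - t₀). The increment estimate then bounds the
norm by C l|t - t₀| times the averages on the plane over t₀, whose norm is finite. -/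
theorem tendsto_eLpNorm_slice_bandConv (h : k + m = d) (hp : p ≠ ⊤)
    (φ : 𝓢(EuclideanSpace ℝ (Fin d), ℂ)) {l : ℝ} (hl : 0 < l)
    {T : EuclideanSpace ℝ (Fin d) → ℂ} (hTm : Measurable T) (hT : MemLp T p)
    (t₀ : EuclideanSpace ℝ (Fin m)) :
    Tendsto (fun t => eLpNorm (fun y => bandConv φ l T (joinCoords h y t) -
      bandConv φ l T (joinCoords h y t₀)) p volume) (𝓝 t₀) (𝓝 0) := by
  obtain ⟨C, hC0, -, hC⟩ := exists_kernel_bound φ (d + 2) 1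
  have hq := one_le_toReal hp
  set A : ℝ≥0∞ := (samplingConst k m d p.toReal * (1 : ℕ) *
    ENNReal.ofReal ((2 * l⁻¹) ^ m)⁻¹) ^ (1 / p.toReal) * eLpNorm T p volume with hA
  have hAt : A ≠ ⊤ := by
    refine ENNReal.mul_ne_top (ENNReal.rpow_ne_top_of_nonneg (by positivity) ?_) hT.2.ne
    exact ENNReal.mul_ne_top (ENNReal.mul_ne_top (samplingConst_lt_top k m d hq).ne (by simp))
      ENNReal.ofReal_ne_top
  have hbound : ∀ᶠ t in 𝓝 t₀, eLpNorm (fun y => bandConv φ l T (joinCoords h y t) -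
      bandConv φ l T (joinCoords h y t₀)) p volume ≤
        ENNReal.ofReal (C * (l * ‖t - t₀‖)) * A := by
    have hnear : ∀ᶠ t in 𝓝 t₀, l * ‖t - t₀‖ < 1 := by
      have hc : Continuous fun t => l * ‖t - t₀‖ := by fun_prop
      refine (hc.tendsto t₀).eventually_lt_const ?_
      simp
    filter_upwards [hnear] with t ht
    have hj : ∀ y : EuclideanSpace ℝ (Fin k),
        joinCoords h y t = joinCoords h y t₀ + joinCoords h 0 (t - t₀) := by
      intro y
      rw [← sub_eq_iff_eq_add', joinCoords_sub, sub_self]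
    have hv : l * ‖joinCoords h (0 : EuclideanSpace ℝ (Fin k)) (t - t₀)‖ ≤ 1 := by
      rw [norm_joinCoords_zero_left]
      exact ht.le
    simp_rw [hj]
    rw [eLpNorm_slice h (fun x => bandConv φ l T (x + joinCoords h 0 (t - t₀)) -
      bandConv φ l T x) t₀]
    have h1 := fun x => enorm_bandConv_add_sub_le hl hC0.le hC hT x hv
    rw [norm_joinCoords_zero_left] at h1
    have h2 := eLpNorm_le_of_enorm_le_average (exponent_ne_zero p) hp h1 ENNReal.ofReal_ne_top
      (lintegral_average_rpow_planeMeasure_le h hl (inv_pos.2 hl) (mul_inv_cancel₀ hl.ne').le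
        (countable_singleton t₀) (fun y => encard_singleton_inter_le t₀ y _) (by fun_prop) hq)
    rwa [mul_assoc] at h2
  have hlim : Tendsto (fun t => ENNReal.ofReal (C * (l * ‖t - t₀‖)) * A) (𝓝 t₀) (𝓝 0) := by
    have hc : Continuous fun t => ENNReal.ofReal (C * (l * ‖t - t₀‖)) :=
      ENNReal.continuous_ofReal.comp (by fun_prop)
    have h3 := ENNReal.Tendsto.mul_const (b := A) (hc.tendsto t₀) (Or.inr hAt)
    simpa using h3
  exact tendsto_of_tendsto_of_tendsto_of_le_of_le' tendsto_const_nhds hlim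
    (Eventually.of_forall fun _ => zero_le) hbound

/-- The representative defined by a series of band-limited functions. -/
def bandSeries (φ : 𝓢(EuclideanSpace ℝ (Fin d), ℂ)) (l : ℕ → ℝ)
    (T : ℕ → EuclideanSpace ℝ (Fin d) → ℂ) (x : EuclideanSpace ℝ (Fin d)) : ℂ :=
  ∑' n, bandConv φ (l n) (T n) x

variable {φ : 𝓢(EuclideanSpace ℝ (Fin d), ℂ)} {l : ℕ → ℝ} {T : ℕ → EuclideanSpace ℝ (Fin d) → ℂ}

/-- The bounds Bₙ do not depend on t; they serve as the dominating sequence for continuity of the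
series. -/
theorem tsum_trace_ne_top (h : k + m = d) (hp : p ≠ ⊤) (hl : ∀ n, 0 < l n)
    (hTm : ∀ n, Measurable (T n))
    (hsum : ∑' n, ENNReal.ofReal (l n ^ ((m : ℝ) / p.toReal)) * eLpNorm (T n) p volume ≠ ⊤) :
    ∃ B : ℕ → ℝ≥0∞, ∑' n, B n ≠ ⊤ ∧ ∀ n (t : EuclideanSpace ℝ (Fin m)),
      eLpNorm (fun y : EuclideanSpace ℝ (Fin k) => bandConv φ (l n) (T n) (joinCoords h y t)) p
        volume ≤ B n := by
  obtain ⟨C, hC, hb⟩ := exists_trace_bound h hp φ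
  refine ⟨fun n => ENNReal.ofReal C *
    (ENNReal.ofReal (l n ^ ((m : ℝ) / p.toReal)) * eLpNorm (T n) p volume), ?_, fun n t => ?_⟩
  · rw [ENNReal.tsum_mul_left]
    exact ENNReal.mul_ne_top ENNReal.ofReal_ne_top hsum
  · refine le_of_le_of_eq ?_ (mul_assoc _ _ _)
    exact hb (l n) (hl n) (T n) (hTm n) t

theorem measurable_slice_bandConv (h : k + m = d) {l : ℝ} {T : EuclideanSpace ℝ (Fin d) → ℂ}
    (hT : Measurable T) (t : EuclideanSpace ℝ (Fin m)) :
    Measurable fun y : EuclideanSpace ℝ (Fin k) => bandConv φ l T (joinCoords h y t) :=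
  (measurable_bandConv l hT).comp (measurableEmbedding_joinCoords_left h t).measurable

theorem memLp_slice_bandSeries (h : k + m = d) (hp : p ≠ ⊤) (hl : ∀ n, 0 < l n)
    (hTm : ∀ n, Measurable (T n))
    (hsum : ∑' n, ENNReal.ofReal (l n ^ ((m : ℝ) / p.toReal)) * eLpNorm (T n) p volume ≠ ⊤)
    (t : EuclideanSpace ℝ (Fin m)) :
    MemLp (fun y : EuclideanSpace ℝ (Fin k) => bandSeries φ l T (joinCoords h y t)) p volume := by
  obtain ⟨B, hB, hle⟩ := tsum_trace_ne_top (φ := φ) h hp hl hTm hsum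
  exact (memLp_tsum_and_eLpNorm_tsum_le
    (fun n => (measurable_slice_bandConv h (hTm n) t).aestronglyMeasurable)
    ((ENNReal.tsum_le_tsum fun n => hle n t).trans_lt hB.lt_top).ne).1

theorem tendsto_eLpNorm_slice_bandSeries (h : k + m = d) (hp : p ≠ ⊤) (hl : ∀ n, 0 < l n)
    (hTm : ∀ n, Measurable (T n)) (hT : ∀ n, MemLp (T n) p)
    (hsum : ∑' n, ENNReal.ofReal (l n ^ ((m : ℝ) / p.toReal)) * eLpNorm (T n) p volume ≠ ⊤)
    (t₀ : EuclideanSpace ℝ (Fin m)) :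
    Tendsto (fun t => eLpNorm (fun y => bandSeries φ l T (joinCoords h y t) -
      bandSeries φ l T (joinCoords h y t₀)) p volume) (𝓝 t₀) (𝓝 0) := by
  obtain ⟨B, hB, hle⟩ := tsum_trace_ne_top (φ := φ) h hp hl hTm hsum
  have hm : ∀ n t, AEStronglyMeasurable (fun y : EuclideanSpace ℝ (Fin k) =>
      bandConv φ (l n) (T n) (joinCoords h y t)) volume :=
    fun n t => (measurable_slice_bandConv h (hTm n) t).aestronglyMeasurable
  have hfin : ∀ t, ∑' n, eLpNorm (fun y : EuclideanSpace ℝ (Fin k) =>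
      bandConv φ (l n) (T n) (joinCoords h y t)) p volume ≠ ⊤ := fun t =>
    ((ENNReal.tsum_le_tsum fun n => hle n t).trans_lt hB.lt_top).ne
  set δ : EuclideanSpace ℝ (Fin m) → ℕ → ℝ≥0∞ := fun t n =>
    eLpNorm (fun y => bandConv φ (l n) (T n) (joinCoords h y t) -
      bandConv φ (l n) (T n) (joinCoords h y t₀)) p volume with hδ
  have hδle : ∀ t n, δ t n ≤ 2 * B n := fun t n =>
    (eLpNorm_sub_le (hm n t) (hm n t₀) Fact.out).trans (by
      rw [two_mul]
      exact add_le_add (hle n t) (hle n t₀))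
  have h2B : ∑' n, 2 * B n ≠ ⊤ := by
    rw [ENNReal.tsum_mul_left]
    exact ENNReal.mul_ne_top (by simp) hB
  have hbound : ∀ t, eLpNorm (fun y => bandSeries φ l T (joinCoords h y t) -
      bandSeries φ l T (joinCoords h y t₀)) p volume ≤ ∑' n, δ t n := by
    intro t
    have hae : (fun y => bandSeries φ l T (joinCoords h y t) -
        bandSeries φ l T (joinCoords h y t₀)) =ᵐ[volume] fun y : EuclideanSpace ℝ (Fin k) =>
          ∑' n, (bandConv φ (l n) (T n) (joinCoords h y t) -
            bandConv φ (l n) (T n) (joinCoords h y t₀)) := by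
      filter_upwards [ae_summable_of_tsum_eLpNorm (fun n => hm n t) (hfin t),
        ae_summable_of_tsum_eLpNorm (fun n => hm n t₀) (hfin t₀)] with y h1 h2
      exact (h1.tsum_sub h2).symm
    rw [eLpNorm_congr_ae hae]
    exact (memLp_tsum_and_eLpNorm_tsum_le (fun n => (hm n t).sub (hm n t₀))
      ((ENNReal.tsum_le_tsum fun n => hδle t n).trans_lt h2B.lt_top).ne).2
  have hlim : Tendsto (fun t => ∑' n, δ t n) (𝓝 t₀) (𝓝 0) := by
    -- Dominated convergence for series, that is, for counting measure on ℕ.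
    have h3 := tendsto_lintegral_filter_of_dominated_convergence (μ := Measure.count)
      (F := δ) (f := fun _ => 0) (l := 𝓝 t₀) (fun n => 2 * B n)
      (Eventually.of_forall fun t => measurable_of_countable _)
      (Eventually.of_forall fun t => Eventually.of_forall fun n => hδle t n)
      (by rwa [lintegral_count])
      (Eventually.of_forall fun n =>
        tendsto_eLpNorm_slice_bandConv h hp φ (hl n) (hTm n) (hT n) t₀)
    simpa [lintegral_count] using h3
  exact tendsto_of_tendsto_of_tendsto_of_le_of_le tendsto_const_nhds hlim
    (fun _ => zero_le) hbound

/-- The sum of a band-limited function and a series of band-limited functions is a trace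
representative. -/
theorem isTraceRepresentative_bandSeries (h : k + m = d) (hp : p ≠ ⊤) {l₀ : ℝ} (hl₀ : 0 < l₀)
    (hl : ∀ n, 0 < l n) {f a : Lp ℂ p (volume : Measure (EuclideanSpace ℝ (Fin d)))}
    {g : ℕ → Lp ℂ p (volume : Measure (EuclideanSpace ℝ (Fin d)))}
    (ha : bandConv φ l₀ a =ᵐ[volume] a) (hg : ∀ n, bandConv φ (l n) (g n) =ᵐ[volume] g n)
    (hsum : ∑' n, ENNReal.ofReal (l n ^ ((m : ℝ) / p.toReal)) * ‖g n‖ₑ ≠ ⊤)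
    (hsum' : ∑' n, ‖g n‖ₑ ≠ ⊤) (hf : a = f - ∑' n, g n) :
    IsTraceRepresentative h p f
      (fun x => bandConv φ l₀ a x + bandSeries φ l (fun n => g n) x) := by
  have hgm : ∀ n, Measurable (g n) := fun n => (Lp.stronglyMeasurable (g n)).measurable
  have ham : Measurable a := (Lp.stronglyMeasurable a).measurable
  have hgL : ∀ n, MemLp (g n) p := fun n => Lp.memLp (g n)
  have hs : ∑' n, ENNReal.ofReal (l n ^ ((m : ℝ) / p.toReal)) * eLpNorm (g n) p volume ≠ ⊤ := by
    simpa only [Lp.enorm_def] using hsum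
  have haL : ∀ t : EuclideanSpace ℝ (Fin m), MemLp (fun y : EuclideanSpace ℝ (Fin k) =>
      bandConv φ l₀ a (joinCoords h y t)) p volume := by
    intro t
    obtain ⟨C, hC, hb⟩ := exists_trace_bound h hp φ
    refine ⟨(measurable_slice_bandConv h ham t).aestronglyMeasurable, ?_⟩
    refine (hb l₀ hl₀ a ham t).trans_lt ?_
    exact ENNReal.mul_lt_top (ENNReal.mul_lt_top ENNReal.ofReal_lt_top ENNReal.ofReal_lt_top)
      (Lp.memLp a).2
  have hsL := memLp_slice_bandSeries (φ := φ) h hp hl hgm hs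
  refine ⟨?_, fun t => (haL t).add (hsL t), fun t₀ => ?_⟩
  · have hfa : f = a + ∑' n, g n := by rw [hf, sub_add_cancel]
    have h2 := Lp.coeFn_add a (∑' n, g n)
    rw [← hfa] at h2
    filter_upwards [ha, ae_all_iff.2 hg, h2, Lp.coeFn_tsum hsum'] with x hx1 hx2 hx3 hx4
    rw [hx3, Pi.add_apply, hx4, hx1, bandSeries]
    simp only [hx2]
  · have h1 := tendsto_eLpNorm_slice_bandConv h hp φ hl₀ ham (Lp.memLp a) t₀
    have h2 := tendsto_eLpNorm_slice_bandSeries (φ := φ) h hp hl hgm hgL hs t₀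
    have h3 := h1.add h2
    rw [add_zero] at h3
    refine tendsto_of_tendsto_of_tendsto_of_le_of_le tendsto_const_nhds h3
      (fun _ => zero_le) fun t => ?_
    refine le_trans (le_of_eq ?_) (eLpNorm_add_le ((haL t).sub (haL t₀)).1
      ((hsL t).sub (hsL t₀)).1 Fact.out)
    congr 1 with y
    simp only [Pi.add_apply]
    ring

/-- Two trace representatives of the same function agree almost everywhere on every plane. -/
theorem IsTraceRepresentative.slice_ae_eq (h : k + m = d) {f g g' : EuclideanSpace ℝ (Fin d) → ℂ}
    (hg : IsTraceRepresentative h p f g) (hg' : IsTraceRepresentative h p f g')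
    (t₀ : EuclideanSpace ℝ (Fin m)) :
    (fun y : EuclideanSpace ℝ (Fin k) => g (joinCoords h y t₀)) =ᵐ[volume]
      fun y => g' (joinCoords h y t₀) := by
  have h1 : g =ᵐ[volume] g' := hg.ae_eq.trans hg'.ae_eq.symm
  have h2 : ∀ᵐ z : EuclideanSpace ℝ (Fin m) × EuclideanSpace ℝ (Fin k) ∂(volume.prod volume),
      g (joinCoords h z.2 z.1) = g' (joinCoords h z.2 z.1) :=
    ((measurePreserving_joinCoords h).comp
      (Measure.measurePreserving_swap (μ := (volume : Measure (EuclideanSpace ℝ (Fin m))))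
        (ν := (volume : Measure (EuclideanSpace ℝ (Fin k)))))).quasiMeasurePreserving.ae h1
  have h3 := Measure.ae_ae_of_ae_prod h2
  -- By Fubini the slices agree for almost every t, and a set of full measure is dense. Continuity
  -- of both traces carries the equality to t₀.
  have hfreq : ∃ᶠ t in 𝓝 t₀, ∀ᵐ y : EuclideanSpace ℝ (Fin k),
      g (joinCoords h y t) = g' (joinCoords h y t) :=
    mem_closure_iff_frequently.1 (Measure.dense_of_ae h3 t₀)
  have hlim := (hg.continuous t₀).add (hg'.continuous t₀)
  rw [add_zero] at hlim
  have hsub : eLpNorm (fun y => g (joinCoords h y t₀) - g' (joinCoords h y t₀)) p volume = 0 := by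
    by_contra hne
    obtain ⟨t, ht, hlt⟩ := (hfreq.and_eventually
      (hlim.eventually_lt_const (pos_iff_ne_zero.2 hne))).exists
    refine hlt.not_ge ?_
    have hae : (fun y => g (joinCoords h y t₀) - g' (joinCoords h y t₀)) =ᵐ[volume]
        (fun y => g' (joinCoords h y t) - g' (joinCoords h y t₀)) -
          fun y => g (joinCoords h y t) - g (joinCoords h y t₀) := by
      filter_upwards [ht] with y hy
      simp only [Pi.sub_apply, hy]
      ring
    rw [eLpNorm_congr_ae hae, add_comm]
    exact eLpNorm_sub_le ((hg'.memLp t).sub (hg'.memLp t₀)).1 ((hg.memLp t).sub (hg.memLp t₀)).1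
      Fact.out
  have h4 := (eLpNorm_eq_zero_iff ((hg.memLp t₀).sub (hg'.memLp t₀)).1 (exponent_ne_zero p)).1 hsub
  filter_upwards [h4] with y hy
  exact sub_eq_zero.1 hy

end Traces

/-! ### Lower sampling bound -/

section LowerBound

variable {k m d : ℕ} {p : ℝ≥0∞} [Fact (1 ≤ p)]

theorem measurePreserving_joinCoords_swap (h : k + m = d) :
    MeasurePreserving (fun z : EuclideanSpace ℝ (Fin m) × EuclideanSpace ℝ (Fin k) =>
      joinCoords h z.2 z.1) (volume.prod volume) volume :=
  (measurePreserving_joinCoords h).comp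
    (Measure.measurePreserving_swap (μ := (volume : Measure (EuclideanSpace ℝ (Fin m))))
      (ν := (volume : Measure (EuclideanSpace ℝ (Fin k)))))

theorem lintegral_eq_lintegral_slices (h : k + m = d) {u : EuclideanSpace ℝ (Fin d) → ℝ≥0∞}
    (hu : Measurable u) :
    ∫⁻ x, u x = ∫⁻ t : EuclideanSpace ℝ (Fin m), ∫⁻ y : EuclideanSpace ℝ (Fin k),
      u (joinCoords h y t) := by
  rw [← (measurePreserving_joinCoords_swap h).lintegral_comp hu, lintegral_prod]
  exact (hu.comp (measurePreserving_joinCoords_swap h).measurable).aemeasurable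

theorem measurable_lintegral_slice (h : k + m = d) {u : EuclideanSpace ℝ (Fin d) → ℝ≥0∞}
    (hu : Measurable u) : Measurable fun t : EuclideanSpace ℝ (Fin m) =>
      ∫⁻ y : EuclideanSpace ℝ (Fin k), u (joinCoords h y t) :=
  (hu.comp (measurePreserving_joinCoords_swap h).measurable).lintegral_prod_right'

/-- Oscillation estimate: over a cover by small cubes, the integral of a band-limited function is
controlled by its samples up to a small multiple of the integral of its averages. -/
theorem lintegral_rpow_le_samples (h : k + m = d) (hp : p ≠ ⊤)
    {φ : 𝓢(EuclideanSpace ℝ (Fin d), ℂ)} {C : ℝ} (hC0 : 0 ≤ C)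
    (hC : ∀ x h, ‖h‖ ≤ m → ‖φ (x + h) - φ x‖ ≤ C * ‖h‖ * ((1 + ‖x‖) ^ (d + 2))⁻¹)
    {l b ε : ℝ} (hl : 0 < l) (hb : 0 < b) (hε : ε ≤ 1) (hlb : l * b ≤ ε)
    {E : Set (EuclideanSpace ℝ (Fin m))} (hE : E.Countable)
    (hcover : ⋃ x ∈ E, cube x b = univ) {D : ℕ}
    (hD : ∀ y : EuclideanSpace ℝ (Fin m), {x ∈ E | y ∈ cube x b}.encard ≤ D)
    {T : EuclideanSpace ℝ (Fin d) → ℂ} (hTm : Measurable T) (hT : MemLp T p)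
    (hTB : bandConv φ l T =ᵐ[volume] T) :
    ∫⁻ x, ‖T x‖ₑ ^ p.toReal ≤
      2 ^ (p.toReal - 1) * (ENNReal.ofReal ((2 * b) ^ m) *
        ∫⁻ x, ‖bandConv φ l T x‖ₑ ^ p.toReal ∂planeMeasure h E) +
      ENNReal.ofReal (C * (m * ε)) ^ p.toReal *
        (2 ^ (p.toReal - 1) * D * decayMass d (d + 2) ^ p.toReal) *
          ∫⁻ x, ‖T x‖ₑ ^ p.toReal := by
  have hq := one_le_toReal hp
  set q := p.toReal with hqdef
  have hcount : Countable E := hE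
  set A := average l (fun z => ‖T z‖ₑ) with hA
  have hAm : Measurable A := measurable_average l (by fun_prop)
  have hBm : Measurable (bandConv φ l T) := measurable_bandConv l hTm
  set η := ENNReal.ofReal (C * (m * ε)) with hη
  set HB : EuclideanSpace ℝ (Fin m) → ℝ≥0∞ := fun t =>
    ∫⁻ y : EuclideanSpace ℝ (Fin k), ‖bandConv φ l T (joinCoords h y t)‖ₑ ^ q with hHB
  set HA : EuclideanSpace ℝ (Fin m) → ℝ≥0∞ := fun t =>
    ∫⁻ y : EuclideanSpace ℝ (Fin k), A (joinCoords h y t) ^ q with hHA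
  have hHAm : Measurable HA := measurable_lintegral_slice h (hAm.pow_const q)
  have h2 : (2 : ℝ≥0∞) ^ (q - 1) ≠ ⊤ := ENNReal.rpow_ne_top_of_nonneg (by linarith) (by simp)
  have hηt : η ^ q ≠ ⊤ := ENNReal.rpow_ne_top_of_nonneg (by linarith) ENNReal.ofReal_ne_top
  -- The samples sit at the centre t but the error term at the moving point x. Integrating x over
  -- all cubes thus gives at most D times the integral of the averages over ℝ^d.
  have hosc : ∀ t : EuclideanSpace ℝ (Fin m), ∀ x ∈ cube t b,
      HB x ≤ 2 ^ (q - 1) * (HB t + η ^ q * HA x) := by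
    intro t x hx
    have hv : ‖joinCoords h (0 : EuclideanSpace ℝ (Fin k)) (t - x)‖ ≤ m * b := by
      rw [norm_joinCoords_zero_left, norm_sub_rev]
      exact norm_sub_le_of_mem_cube hb.le hx
    have hlv : l * ‖joinCoords h (0 : EuclideanSpace ℝ (Fin k)) (t - x)‖ ≤ m * ε := by
      calc _ ≤ l * (m * b) := by gcongr
        _ = m * (l * b) := by ring
        _ ≤ m * ε := by gcongr
    have hpt : ∀ y : EuclideanSpace ℝ (Fin k), ‖bandConv φ l T (joinCoords h y x)‖ₑ ≤
        ‖bandConv φ l T (joinCoords h y t)‖ₑ + η * A (joinCoords h y x) := by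
      intro y
      have hj : joinCoords h y t = joinCoords h y x + joinCoords h 0 (t - x) := by
        rw [← sub_eq_iff_eq_add', joinCoords_sub, sub_self]
      have h1 := enorm_bandConv_add_sub_le hl hC0 hC hT (joinCoords h y x)
        (hlv.trans (mul_le_of_le_one_right (by positivity) hε))
      rw [← hj] at h1
      have h3 : ‖bandConv φ l T (joinCoords h y x)‖ₑ ≤ ‖bandConv φ l T (joinCoords h y t)‖ₑ +
          ‖bandConv φ l T (joinCoords h y t) - bandConv φ l T (joinCoords h y x)‖ₑ := by
        have := enorm_sub_le (a := bandConv φ l T (joinCoords h y t))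
          (b := bandConv φ l T (joinCoords h y t) - bandConv φ l T (joinCoords h y x))
        rwa [sub_sub_cancel] at this
      refine h3.trans (add_le_add_right (h1.trans ?_) _)
      refine mul_le_mul_left (ENNReal.ofReal_le_ofReal ?_) _
      gcongr
    have hm1 : Measurable fun y : EuclideanSpace ℝ (Fin k) =>
        ‖bandConv φ l T (joinCoords h y t)‖ₑ ^ q :=
      (measurable_slice_bandConv h hTm t).enorm.pow_const q
    calc HB x ≤ ∫⁻ y : EuclideanSpace ℝ (Fin k), 2 ^ (q - 1) *
          (‖bandConv φ l T (joinCoords h y t)‖ₑ ^ q + η ^ q * A (joinCoords h y x) ^ q) := by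
          refine lintegral_mono fun y => ?_
          rw [← ENNReal.mul_rpow_of_nonneg _ _ (by linarith)]
          exact (ENNReal.rpow_le_rpow (hpt y) (by linarith)).trans
            (ENNReal.rpow_add_le_mul_rpow_add_rpow _ _ hq)
      _ = _ := by
          rw [lintegral_const_mul' _ _ h2, lintegral_add_left hm1, lintegral_const_mul' _ _ hηt]
  have hcubes : ∑' t : E, ∫⁻ x in cube (t : EuclideanSpace ℝ (Fin m)) b, HA x ≤
      D * ∫⁻ x, A x ^ q := by
    calc _ = ∫⁻ x, (∑' t : E, (cube (t : EuclideanSpace ℝ (Fin m)) b).indicator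
            (fun _ => (1 : ℝ≥0∞)) x) * HA x := by
          simp_rw [← ENNReal.tsum_mul_right]
          have hm1 : ∀ t : E, AEMeasurable (fun x => (cube (t : EuclideanSpace ℝ (Fin m)) b).indicator
              (fun _ => (1 : ℝ≥0∞)) x * HA x) volume := fun t =>
            ((measurable_const.indicator (measurableSet_cube _ _)).mul hHAm).aemeasurable
          rw [lintegral_tsum hm1]
          refine tsum_congr fun t => ?_
          rw [← lintegral_indicator (measurableSet_cube _ _)]
          refine lintegral_congr fun x => ?_
          by_cases hx : x ∈ cube (t : EuclideanSpace ℝ (Fin m)) b <;> simp [hx]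
      _ ≤ ∫⁻ x, D * HA x := by
          gcongr with x
          exact tsum_indicator_cube_le hD x
      _ = _ := by
          rw [lintegral_const_mul _ hHAm, lintegral_eq_lintegral_slices h (hAm.pow_const q)]
  calc ∫⁻ x, ‖T x‖ₑ ^ q = ∫⁻ x, ‖bandConv φ l T x‖ₑ ^ q :=
        lintegral_congr_ae (hTB.mono fun x hx => by simp only [hx])
    _ = ∫⁻ x, HB x := lintegral_eq_lintegral_slices h (hBm.enorm.pow_const q)
    _ = ∫⁻ x in ⋃ t : E, cube (t : EuclideanSpace ℝ (Fin m)) b, HB x := by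
        rw [← biUnion_eq_iUnion E fun t _ => cube t b, hcover, Measure.restrict_univ]
    _ ≤ ∑' t : E, ∫⁻ x in cube (t : EuclideanSpace ℝ (Fin m)) b, HB x := lintegral_iUnion_le _ _
    _ ≤ ∑' t : E, ∫⁻ x in cube (t : EuclideanSpace ℝ (Fin m)) b,
          2 ^ (q - 1) * (HB t + η ^ q * HA x) :=
        ENNReal.tsum_le_tsum fun t => setLIntegral_mono' (measurableSet_cube _ _) (hosc t)
    _ = 2 ^ (q - 1) * (ENNReal.ofReal ((2 * b) ^ m) * ∑' t : E, HB t +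
          η ^ q * ∑' t : E, ∫⁻ x in cube (t : EuclideanSpace ℝ (Fin m)) b, HA x) := by
        rw [← ENNReal.tsum_mul_left, ← ENNReal.tsum_mul_left, ← ENNReal.tsum_add,
          ← ENNReal.tsum_mul_left]
        refine tsum_congr fun t => ?_
        rw [lintegral_const_mul' _ _ h2, lintegral_add_left measurable_const,
          lintegral_const_mul' _ _ hηt, setLIntegral_const, volume_cube _ hb.le, mul_comm (HB t)]
    _ ≤ 2 ^ (q - 1) * (ENNReal.ofReal ((2 * b) ^ m) * ∑' t : E, HB t +
          η ^ q * (D * (decayMass d (d + 2) ^ q * ∫⁻ x, ‖T x‖ₑ ^ q))) := by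
        gcongr
        refine hcubes.trans ?_
        gcongr
        exact lintegral_average_rpow_volume_le hl (by fun_prop) hq
    _ = _ := by
        rw [lintegral_planeMeasure]
        ring

/-- Lower Plancherel–Pólya inequality for sampling on unions of planes. -/
theorem exists_lower_bound (h : k + m = d) (hp : p ≠ ⊤)
    (φ : 𝓢(EuclideanSpace ℝ (Fin d), ℂ)) (D : ℕ) :
    ∃ ε C : ℝ, 0 < ε ∧ ε ≤ 1 ∧ 0 < C ∧ ∀ l b : ℝ, 0 < l → 0 < b → l * b ≤ ε →
      ∀ E : Set (EuclideanSpace ℝ (Fin m)), E.Countable → ⋃ x ∈ E, cube x b = univ →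
      (∀ y : EuclideanSpace ℝ (Fin m), {x ∈ E | y ∈ cube x b}.encard ≤ D) →
      ∀ T : EuclideanSpace ℝ (Fin d) → ℂ, Measurable T → MemLp T p →
      bandConv φ l T =ᵐ[volume] T →
      eLpNorm T p volume ≤ ENNReal.ofReal C * (ENNReal.ofReal (b ^ ((m : ℝ) / p.toReal)) *
        eLpNorm (bandConv φ l T) p (planeMeasure h E)) := by
  have hq := one_le_toReal hp
  have hq0 : 0 < p.toReal := by linarith
  -- The radius m suffices: a point of a cube is within mb of the centre, and l(mb) ≤ mε ≤ m.
  obtain ⟨C, hC0, -, hC⟩ := exists_kernel_bound φ (d + 2) m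
  set K : ℝ≥0∞ := 2 ^ (p.toReal - 1) * D * decayMass d (d + 2) ^ p.toReal with hK
  have hKt : K ≠ ⊤ := by
    refine ENNReal.mul_ne_top (ENNReal.mul_ne_top ?_ (by simp)) ?_
    · exact ENNReal.rpow_ne_top_of_nonneg (by linarith) (by simp)
    · exact ENNReal.rpow_ne_top_of_nonneg hq0.le (decayMass_lt_top (by omega)).ne
  -- ε is small enough for the oscillation term to be at most half of ∫ |T|^p, which is finite and
  -- can be absorbed.
  obtain ⟨ε, hε0, hε1, hεK⟩ : ∃ ε : ℝ, 0 < ε ∧ ε ≤ 1 ∧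
      ENNReal.ofReal (C * (m * ε)) ^ p.toReal * K ≤ 2⁻¹ := by
    have hc : Continuous fun ε : ℝ => ENNReal.ofReal (C * (m * ε)) ^ p.toReal :=
      ENNReal.continuous_rpow_const.comp (ENNReal.continuous_ofReal.comp (by fun_prop))
    have h1 := ENNReal.Tendsto.mul_const (b := K) (hc.tendsto 0) (Or.inr hKt)
    simp only [mul_zero, ENNReal.ofReal_zero, ENNReal.zero_rpow_of_pos hq0, zero_mul] at h1
    have h2 : ∀ᶠ ε in 𝓝[>] (0 : ℝ), ENNReal.ofReal (C * (m * ε)) ^ p.toReal * K < 2⁻¹ :=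
      (h1.mono_left nhdsWithin_le_nhds).eventually_lt_const (by simp)
    have h3 : ∀ᶠ ε in 𝓝[>] (0 : ℝ), ε ∈ Ioc (0 : ℝ) 1 := Ioc_mem_nhdsGT zero_lt_one
    obtain ⟨ε, h4, h5⟩ := (h2.and h3).exists
    exact ⟨ε, h5.1, h5.2, h4.le⟩
  -- After absorption the factor is 2 · 2^{p-1} (2b)^m = 2^p (2b)^m; its p-th root is 2 · 2^{m/p}
  -- b^{m/p}.
  refine ⟨ε, 2 * 2 ^ ((m : ℝ) / p.toReal), hε0, hε1, by positivity, ?_⟩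
  intro l b hl hb hlb E hE hcover hD T hTm hT hTB
  have key := lintegral_rpow_le_samples h hp hC0.le hC hl hb hε1 hlb hE hcover hD hTm hT hTB
  set X := ∫⁻ x, ‖T x‖ₑ ^ p.toReal with hX
  set Y := ∫⁻ x, ‖bandConv φ l T x‖ₑ ^ p.toReal ∂planeMeasure h E with hY
  have hXt : X ≠ ⊤ :=
    (lintegral_rpow_enorm_lt_top_of_eLpNorm_lt_top (exponent_ne_zero p) hp hT.2).ne
  have h1 : X ≤ 2 ^ (p.toReal - 1) * (ENNReal.ofReal ((2 * b) ^ m) * Y) + 2⁻¹ * X :=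
    key.trans (by gcongr)
  have h2 : X ≤ 2 * (2 ^ (p.toReal - 1) * (ENNReal.ofReal ((2 * b) ^ m) * Y)) := by
    have h3 : 2⁻¹ * X + 2⁻¹ * X = X := by
      rw [← add_mul, ENNReal.inv_two_add_inv_two, one_mul]
    have h4 : 2⁻¹ * X ≤ 2 ^ (p.toReal - 1) * (ENNReal.ofReal ((2 * b) ^ m) * Y) := by
      refine (ENNReal.add_le_add_iff_right (a := 2⁻¹ * X)
        (ENNReal.mul_ne_top (by simp) hXt)).1 ?_
      rw [h3]
      exact h1
    calc X = 2 * (2⁻¹ * X) := by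
          rw [← mul_assoc, ENNReal.mul_inv_cancel (by simp) (by simp), one_mul]
      _ ≤ _ := by gcongr
  have h5 : X ≤ 2 ^ p.toReal * (ENNReal.ofReal ((2 * b) ^ m) * Y) := by
    refine h2.trans_eq ?_
    rw [← mul_assoc]
    congr 1
    calc (2 : ℝ≥0∞) * 2 ^ (p.toReal - 1) = 2 ^ (1 : ℝ) * 2 ^ (p.toReal - 1) := by simp
      _ = _ := by
        rw [← ENNReal.rpow_add _ _ (by simp) (by simp)]
        simp
  rw [eLpNorm_eq_lintegral_rpow_enorm_toReal (exponent_ne_zero p) hp,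
    eLpNorm_eq_lintegral_rpow_enorm_toReal (exponent_ne_zero p) hp]
  calc X ^ (1 / p.toReal) ≤ (2 ^ p.toReal * (ENNReal.ofReal ((2 * b) ^ m) * Y)) ^ (1 / p.toReal) := by
        gcongr
    _ = _ := by
        rw [ENNReal.mul_rpow_of_nonneg _ _ (by positivity),
          ENNReal.mul_rpow_of_nonneg _ _ (by positivity), ← ENNReal.rpow_mul,
          mul_one_div_cancel hq0.ne', ENNReal.rpow_one,
          ENNReal.ofReal_rpow_of_nonneg (by positivity) (by positivity), ← Real.rpow_natCast,
          ← Real.rpow_mul (by positivity), mul_one_div, Real.mul_rpow zero_le_two hb.le,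
          ENNReal.ofReal_mul (by positivity), ENNReal.ofReal_mul zero_le_two]
        simp only [ENNReal.ofReal_ofNat]
        ring

end LowerBound

/-! ### Low and high frequencies combined -/

section Main

variable {k m d : ℕ} {p : ℝ≥0∞} [Fact (1 ≤ p)]

theorem sobolev_exponent_pos (hm : 0 < m) (hp : p ≠ ⊤) : 0 < (m : ℝ) / p.toReal := by
  have := one_le_toReal hp
  positivity

/-- Decomposition at frequency `2^j₀`, together with the trace representative it defines. -/
theorem exists_trace_decomposition (h : k + m = d) (hm : 0 < m) (hp : p ≠ ⊤)
    {ρ : EuclideanSpace ℝ (Fin d) → ℝ} (hρ : IsDyadicPartition ρ)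
    (f : Lp ℂ p (volume : Measure (EuclideanSpace ℝ (Fin d))))
    (hf : MemBesov ρ ((m : ℝ) / p.toReal) p f) (j₀ : ℤ) :
    ∃ (a : Lp ℂ p (volume : Measure (EuclideanSpace ℝ (Fin d))))
      (g : ℕ → Lp ℂ p (volume : Measure (EuclideanSpace ℝ (Fin d)))),
      bandConv (bandKernel d) ((2 : ℝ) ^ j₀) a =ᵐ[volume] a ∧
      ∑' n : ℕ, ENNReal.ofReal (((2 : ℝ) ^ (j₀ + n)) ^ ((m : ℝ) / p.toReal)) * ‖g n‖ₑ ≤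
        homBesovNorm ρ ((m : ℝ) / p.toReal) p (f : 𝓢'(EuclideanSpace ℝ (Fin d), ℂ)) ∧
      a = f - ∑' n, g n ∧
      IsTraceRepresentative h p f (fun x => bandConv (bandKernel d) ((2 : ℝ) ^ j₀) a x +
        bandSeries (bandKernel d) (fun n => (2 : ℝ) ^ (j₀ + n + 1)) (fun n => g n) x) := by
  have hs := sobolev_exponent_pos (p := p) hm hp
  obtain ⟨a, g, ha, hg, hle, hsum, hfa⟩ := exists_decomposition hp hρ hs f hf j₀
  refine ⟨a, g, ha, hle, hfa, isTraceRepresentative_bandSeries h hp (by positivity)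
    (fun n => by positivity) ha hg ?_ hsum hfa⟩
  have h1 : ∀ n : ℕ, ENNReal.ofReal (((2 : ℝ) ^ (j₀ + n + 1)) ^ ((m : ℝ) / p.toReal)) * ‖g n‖ₑ =
      ENNReal.ofReal (2 ^ ((m : ℝ) / p.toReal)) *
        (ENNReal.ofReal (((2 : ℝ) ^ (j₀ + n)) ^ ((m : ℝ) / p.toReal)) * ‖g n‖ₑ) := by
    intro n
    rw [← mul_assoc, ← ENNReal.ofReal_mul (by positivity),
      ← Real.mul_rpow zero_le_two (by positivity), zpow_add_one₀ two_ne_zero, mul_comm (2 : ℝ)]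
  simp_rw [h1]
  rw [ENNReal.tsum_mul_left]
  exact ENNReal.mul_ne_top ENNReal.ofReal_ne_top (hle.trans_lt hf).ne

theorem eLpNorm_planeMeasure_congr (h : k + m = d) (hp : p ≠ ⊤)
    {f g g' : EuclideanSpace ℝ (Fin d) → ℂ} (hg : IsTraceRepresentative h p f g)
    (hg' : IsTraceRepresentative h p f g') (E : Set (EuclideanSpace ℝ (Fin m))) :
    eLpNorm g p (planeMeasure h E) = eLpNorm g' p (planeMeasure h E) := by
  rw [eLpNorm_eq_lintegral_rpow_enorm_toReal (exponent_ne_zero p) hp,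
    eLpNorm_eq_lintegral_rpow_enorm_toReal (exponent_ne_zero p) hp, lintegral_planeMeasure,
    lintegral_planeMeasure]
  congr 1
  refine tsum_congr fun t => lintegral_congr_ae ?_
  filter_upwards [hg.slice_ae_eq h hg' t] with y hy
  rw [hy]

theorem lintegral_planes_eq_eLpNorm (h : k + m = d) (hp : p ≠ ⊤)
    {E : Set (EuclideanSpace ℝ (Fin m))} (hE : E.Countable) (g : EuclideanSpace ℝ (Fin d) → ℂ) :
    (∫⁻ x in planes h E, ‖g x‖ₑ ^ p.toReal ∂μHE[k]) ^ (1 / p.toReal) =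
      eLpNorm g p (planeMeasure h E) := by
  rw [restrict_planes_eq_planeMeasure h hE,
    eLpNorm_eq_lintegral_rpow_enorm_toReal (exponent_ne_zero p) hp]

/-- The high frequency part, sampled on planes. -/
theorem eLpNorm_bandSeries_planeMeasure_le (h : k + m = d) {φ : 𝓢(EuclideanSpace ℝ (Fin d), ℂ)}
    {C : ℝ} {D : ℕ} {ε b s : ℝ} (hε0 : 0 < ε) (hε1 : ε ≤ 1) (hb : 0 < b)
    (hsd : s = (m : ℝ) / p.toReal)
    {E : Set (EuclideanSpace ℝ (Fin m))} (hE : E.Countable)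
    (hD : ∀ y : EuclideanSpace ℝ (Fin m), {x ∈ E | y ∈ cube x b}.encard ≤ D)
    (hsamp : ∀ (l β : ℝ), 0 < l → 0 < β → l * β ≤ 1 →
      ∀ E : Set (EuclideanSpace ℝ (Fin m)), E.Countable → ∀ D : ℕ,
      (∀ y : EuclideanSpace ℝ (Fin m), {x ∈ E | y ∈ cube x β}.encard ≤ D) →
      ∀ T : EuclideanSpace ℝ (Fin d) → ℂ, Measurable T →
      eLpNorm (bandConv φ l T) p (planeMeasure h E) ≤
        ENNReal.ofReal C * (D : ℝ≥0∞) ^ (1 / p.toReal) *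
          ENNReal.ofReal ((β ^ ((m : ℝ) / p.toReal))⁻¹) * eLpNorm T p volume)
    {l : ℕ → ℝ} (hl : ∀ n, ε ≤ 2 * l n * b)
    {g : ℕ → Lp ℂ p (volume : Measure (EuclideanSpace ℝ (Fin d)))}
    (hsum : ∑' n : ℕ, ENNReal.ofReal (l n ^ s) * ‖g n‖ₑ ≠ ⊤) :
    MemLp (bandSeries φ (fun n => 2 * l n) fun n => g n) p (planeMeasure h E) ∧
    ENNReal.ofReal (b ^ s) *
        eLpNorm (bandSeries φ (fun n => 2 * l n) fun n => g n) p (planeMeasure h E) ≤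
      ENNReal.ofReal C * (D : ℝ≥0∞) ^ (1 / p.toReal) * (ENNReal.ofReal ((2 / ε) ^ s * b ^ s) *
        ∑' n : ℕ, ENNReal.ofReal (l n ^ s) * ‖g n‖ₑ) := by
  have hl0 : ∀ n, 0 < l n := fun n => by
    have h1 : 0 < 2 * l n * b := hε0.trans_le (hl n)
    have h2 := pos_of_mul_pos_left h1 hb.le
    linarith
  set K : ℝ≥0∞ := ENNReal.ofReal C * (D : ℝ≥0∞) ^ (1 / p.toReal) with hK
  have hKt : K ≠ ⊤ := ENNReal.mul_ne_top ENNReal.ofReal_ne_top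
    (ENNReal.rpow_ne_top_of_nonneg (by positivity) (ENNReal.natCast_ne_top D))
  have hbound : ∀ n, eLpNorm (bandConv φ (2 * l n) (g n)) p (planeMeasure h E) ≤
      K * ENNReal.ofReal ((2 / ε) ^ s) * (ENNReal.ofReal (l n ^ s) * ‖g n‖ₑ) := by
    intro n
    have hn := hl0 n
    have hβb : ε / (2 * l n) ≤ b := (div_le_iff₀' (by positivity)).2 (hl n)
    -- The block is reproduced at scale 2lₙ, so the half-side ε/(2lₙ) gives the product ε ≤ 1. It is
    -- at most b, so the shrunken cubes still overlap at most D times.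
    refine (hsamp (2 * l n) (ε / (2 * l n)) (by positivity) (by positivity)
      ((mul_div_cancel₀ ε (by positivity)).trans_le hε1) E hE D
      (fun y => (encard_le_encard (t := {x ∈ E | y ∈ cube x b})
        fun x hx => ⟨hx.1, cube_subset_cube x hβb hx.2⟩).trans (hD y))
      (g n) (Lp.stronglyMeasurable (g n)).measurable).trans_eq ?_
    have h1 : ((ε / (2 * l n)) ^ s)⁻¹ = (2 / ε) ^ s * l n ^ s := by
      rw [← Real.inv_rpow (by positivity), ← Real.mul_rpow (by positivity) hn.le]
      congr 1
      field_simp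
    rw [← hsd, h1, ENNReal.ofReal_mul (by positivity), Lp.enorm_def]
    ring
  have hle := (ENNReal.tsum_le_tsum hbound).trans_eq ENNReal.tsum_mul_left
  obtain ⟨hmem, hsm⟩ := memLp_tsum_and_eLpNorm_tsum_le (p := p) (μ := planeMeasure h E)
    (F := fun n => bandConv φ (2 * l n) (g n))
    (fun n => (measurable_bandConv _ (Lp.stronglyMeasurable (g n)).measurable).aestronglyMeasurable)
    (hle.trans_lt (ENNReal.mul_lt_top (ENNReal.mul_lt_top hKt.lt_top ENNReal.ofReal_lt_top)
      hsum.lt_top)).ne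
  refine ⟨hmem, (mul_le_mul_right (hsm.trans hle) _).trans_eq ?_⟩
  rw [ENNReal.ofReal_mul (by positivity)]
  ring

/-- Norm equivalence for trace representatives, in terms of `planeMeasure`. -/
theorem exists_sampling_constants (h : k + m = d) (hm : 0 < m) (hp : p ≠ ⊤) (D : ℕ) :
    ∃ δ > (0 : ℝ), ∃ C₁ > (0 : ℝ), ∃ C₂ > (0 : ℝ),
      ∀ ρ : EuclideanSpace ℝ (Fin d) → ℝ, IsDyadicPartition ρ →
      ∀ f : Lp ℂ p (volume : Measure (EuclideanSpace ℝ (Fin d))),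
        MemBesov ρ ((m : ℝ) / p.toReal) p f → ∀ N b : ℝ, 0 < N → 0 < b →
          homBesovNorm ρ ((m : ℝ) / p.toReal) p (f : 𝓢'(EuclideanSpace ℝ (Fin d), ℂ))
            ≤ ENNReal.ofReal N * eLpNorm f p volume →
          b ^ ((m : ℝ) / p.toReal) < δ * N⁻¹ →
          ∀ E : Set (EuclideanSpace ℝ (Fin m)), E.Countable → ⋃ x ∈ E, cube x b = univ →
            (∀ y : EuclideanSpace ℝ (Fin m), {x ∈ E | y ∈ cube x b}.encard ≤ D) →
            ∀ g : EuclideanSpace ℝ (Fin d) → ℂ, IsTraceRepresentative h p f g →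
              ENNReal.ofReal C₁ * eLpNorm f p volume ≤
                ENNReal.ofReal (b ^ ((m : ℝ) / p.toReal)) * eLpNorm g p (planeMeasure h E) ∧
              ENNReal.ofReal (b ^ ((m : ℝ) / p.toReal)) * eLpNorm g p (planeMeasure h E) ≤
                ENNReal.ofReal C₂ * eLpNorm f p volume := by
  have hs := sobolev_exponent_pos (p := p) hm hp
  have hq := one_le_toReal hp
  obtain ⟨Ca, hCa, hsamp⟩ := exists_sampling_bound h hp (bandKernel d)
  obtain ⟨ε, CL, hε0, hε1, hCL, hlow⟩ := exists_lower_bound h hp (bandKernel d) D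
  set s := (m : ℝ) / p.toReal with hsd
  set M : ℝ := Ca * (D : ℝ) ^ (1 / p.toReal) with hM
  have hM0 : 0 ≤ M := by positivity
  have hMe : ENNReal.ofReal Ca * (D : ℝ≥0∞) ^ (1 / p.toReal) = ENNReal.ofReal M := by
    rw [hM, ENNReal.ofReal_mul hCa.le, ← ENNReal.ofReal_rpow_of_nonneg (by positivity)
      (by positivity), ENNReal.ofReal_natCast]
  -- In the lower bound the high part enters twice: through its samples, costing CL · M · η, and
  -- through its own norm, costing η. Together these are 1/2.
  set η : ℝ := (2 * (CL * M + 1))⁻¹ with hη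
  have hη0 : 0 < η := by positivity
  have hηM : (CL * M + 1) * η = 2⁻¹ := by
    rw [hη]
    field_simp
  -- This δ gives (2/ε)^s b^s N ≤ η. C₁ comes from absorbing half of ‖f‖_p; C₂ adds M(1 + η) for the
  -- low part and Mη for the high part. The extra 1 keeps C₂ positive when D = 0.
  refine ⟨η / (2 / ε) ^ s, by positivity, (2 * CL)⁻¹, by positivity, M * (1 + η) + M * η + 1,
    by positivity, ?_⟩
  intro ρ hρ f hf N b hN hb hfN hbδ E hE hcover hD G hG
  -- 2^{j₀} ≤ ε/b allows the lower bound for the low part; ε/b < 2^{j₀+1} makes the shrunken cubes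
  -- for every high block fit inside those of half-side b.
  obtain ⟨j₀, hj1, hj2⟩ := exists_mem_Ico_zpow (x := ε / b) (y := (2 : ℝ)) (by positivity)
    one_lt_two
  obtain ⟨a, g, ha, hle, hfa, hrep⟩ := exists_trace_decomposition h hm hp hρ f hf j₀
  rw [← hsd] at hle
  rw [eLpNorm_planeMeasure_congr h hp hG hrep E]
  set F := eLpNorm f p volume with hF
  set B := homBesovNorm ρ s p (f : 𝓢'(EuclideanSpace ℝ (Fin d), ℂ)) with hB
  have hFt : F ≠ ⊤ := (Lp.memLp f).2.ne
  have hlb : (2 : ℝ) ^ j₀ * b ≤ ε := (le_div_iff₀ hb).1 hj1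
  have hlb' : ε ≤ 2 * (2 : ℝ) ^ j₀ * b := by
    have := (div_lt_iff₀ hb).1 hj2
    rw [zpow_add_one₀ two_ne_zero] at this
    linarith
  have hηF : ENNReal.ofReal ((2 / ε) ^ s * b ^ s) * B ≤ ENNReal.ofReal η * F := by
    calc _ ≤ ENNReal.ofReal ((2 / ε) ^ s * b ^ s) * (ENNReal.ofReal N * F) := by gcongr
      _ = ENNReal.ofReal ((2 / ε) ^ s * b ^ s * N) * F := by
        rw [← mul_assoc, ← ENNReal.ofReal_mul (by positivity)]
      _ ≤ _ := by
        gcongr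
        have h1 : b ^ s * N ≤ η / (2 / ε) ^ s := by
          rw [← div_eq_mul_inv, lt_div_iff₀ hN] at hbδ
          exact hbδ.le
        rw [mul_assoc]
        calc _ ≤ (2 / ε) ^ s * (η / (2 / ε) ^ s) := by gcongr
          _ = η := mul_div_cancel₀ _ (by positivity)
  set W := ∑' n : ℕ, ENNReal.ofReal (((2 : ℝ) ^ (j₀ + n)) ^ s) * ‖g n‖ₑ with hW
  have hWt : W ≠ ⊤ := (hle.trans_lt hf).ne
  -- Since 2 · 2^{j₀+n} b/ε ≥ 1, the weights (2/ε)^s b^s 2^{(j₀+n)s} are at least one, so the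
  -- weighted sum dominates the plain one.
  have hH : ‖∑' n, g n‖ₑ ≤ ENNReal.ofReal η * F := by
    refine le_trans ?_ ((mul_le_mul_right hle _).trans hηF)
    refine enorm_tsum_le_tsum_enorm.trans ?_
    rw [hW, ← ENNReal.tsum_mul_left]
    refine ENNReal.tsum_le_tsum fun n => ?_
    rw [← mul_assoc, ← ENNReal.ofReal_mul (by positivity)]
    refine le_mul_of_one_le_left' ?_
    rw [ENNReal.one_le_ofReal, ← Real.mul_rpow (by positivity) hb.le,
      ← Real.mul_rpow (by positivity) (by positivity)]
    refine Real.one_le_rpow ?_ hs.le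
    have h1 : (2 : ℝ) ^ j₀ ≤ (2 : ℝ) ^ (j₀ + n) := zpow_le_zpow_right₀ one_le_two (by omega)
    calc (1 : ℝ) = ε / ε := (div_self hε0.ne').symm
      _ ≤ 2 * (2 : ℝ) ^ (j₀ + n) * b / ε := by
        have : 2 * (2 : ℝ) ^ j₀ * b ≤ 2 * (2 : ℝ) ^ (j₀ + n) * b := by gcongr
        gcongr
        linarith
      _ = _ := by ring
  have hhigh := eLpNorm_bandSeries_planeMeasure_le (g := g) (l := fun n => (2 : ℝ) ^ (j₀ + n)) h
    hε0 hε1 hb hsd hE hD hsamp (fun n => by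
      refine hlb'.trans ?_
      have h1 : (2 : ℝ) ^ j₀ ≤ (2 : ℝ) ^ (j₀ + n) := zpow_le_zpow_right₀ one_le_two (by omega)
      gcongr) hWt
  have hl2 : (fun n : ℕ => 2 * (2 : ℝ) ^ (j₀ + n)) = fun n : ℕ => (2 : ℝ) ^ (j₀ + n + 1) := by
    ext n
    rw [zpow_add_one₀ two_ne_zero, mul_comm]
  rw [hl2, hMe] at hhigh
  obtain ⟨hhm, hhle⟩ := hhigh
  set low := bandConv (bandKernel d) ((2 : ℝ) ^ j₀) a with hlowdef
  set high := bandSeries (bandKernel d) (fun n : ℕ => (2 : ℝ) ^ (j₀ + n + 1)) (fun n => g n)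
    with hhighdef
  set ν := planeMeasure h E with hν
  have ham : Measurable a := (Lp.stronglyMeasurable a).measurable
  have hlowm : AEStronglyMeasurable low ν := (measurable_bandConv _ ham).aestronglyMeasurable
  have hHG : ENNReal.ofReal (b ^ s) * eLpNorm high p ν ≤ ENNReal.ofReal (M * η) * F := by
    refine hhle.trans ?_
    rw [ENNReal.ofReal_mul hM0, mul_assoc]
    exact mul_le_mul_right ((mul_le_mul_right hle _).trans hηF) _
  have hLG : ENNReal.ofReal (b ^ s) * eLpNorm low p ν ≤ ENNReal.ofReal M * ‖a‖ₑ := by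
    have h1 := hsamp ((2 : ℝ) ^ j₀) b (by positivity) hb (hlb.trans hε1) E hE D hD a ham
    rw [hMe] at h1
    refine (mul_le_mul_right h1 _).trans_eq ?_
    rw [← mul_assoc, mul_comm (ENNReal.ofReal M), ← mul_assoc, ← ENNReal.ofReal_mul (by positivity),
      mul_inv_cancel₀ (by positivity), ENNReal.ofReal_one, one_mul, Lp.enorm_def]
  have haL : ‖a‖ₑ ≤ ENNReal.ofReal CL * (ENNReal.ofReal (b ^ s) * eLpNorm low p ν) := by
    rw [Lp.enorm_def]
    exact hlow ((2 : ℝ) ^ j₀) b (by positivity) hb hlb E hE hcover hD a ham (Lp.memLp a) ha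
  have haF : ‖a‖ₑ ≤ F + ENNReal.ofReal η * F := by
    rw [hfa]
    refine enorm_sub_le.trans ?_
    rw [Lp.enorm_def f]
    gcongr
  have hFa : F ≤ ‖a‖ₑ + ENNReal.ofReal η * F := by
    have h1 : f = a + ∑' n, g n := by rw [hfa, sub_add_cancel]
    calc F = ‖f‖ₑ := (Lp.enorm_def f).symm
      _ ≤ ‖a‖ₑ + ‖∑' n, g n‖ₑ := by
        conv_lhs => rw [h1]
        exact enorm_add_le _ _
      _ ≤ _ := by gcongr
  set X := eLpNorm (fun x => low x + high x) p ν with hX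
  have hXle : X ≤ eLpNorm low p ν + eLpNorm high p ν := eLpNorm_add_le hlowm hhm.1 Fact.out
  have hleX : eLpNorm low p ν ≤ X + eLpNorm high p ν := by
    have h1 : low = (fun x => low x + high x) - high := by
      ext x
      simp
    conv_lhs => rw [h1]
    exact eLpNorm_sub_le (hlowm.add hhm.1) hhm.1 Fact.out
  constructor
  · have h1 : F ≤ ENNReal.ofReal CL * (ENNReal.ofReal (b ^ s) * X) + 2⁻¹ * F := by
      calc F ≤ ‖a‖ₑ + ENNReal.ofReal η * F := hFa
        _ ≤ ENNReal.ofReal CL * (ENNReal.ofReal (b ^ s) * (X + eLpNorm high p ν)) +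
              ENNReal.ofReal η * F := by
            gcongr
            refine haL.trans ?_
            gcongr
        _ ≤ ENNReal.ofReal CL * (ENNReal.ofReal (b ^ s) * X + ENNReal.ofReal (M * η) * F) +
              ENNReal.ofReal η * F := by
            gcongr
            rw [mul_add]
            gcongr
        _ = ENNReal.ofReal CL * (ENNReal.ofReal (b ^ s) * X) +
              (ENNReal.ofReal CL * ENNReal.ofReal (M * η) + ENNReal.ofReal η) * F := by ring
        _ = _ := by
            rw [← ENNReal.ofReal_mul hCL.le, ← ENNReal.ofReal_add (by positivity) hη0.le,
              show CL * (M * η) + η = 2⁻¹ by rw [← hηM]; ring, ENNReal.ofReal_inv_of_pos two_pos,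
              ENNReal.ofReal_ofNat]
    have h2 : 2⁻¹ * F ≤ ENNReal.ofReal CL * (ENNReal.ofReal (b ^ s) * X) := by
      refine (ENNReal.add_le_add_iff_right (a := 2⁻¹ * F) (ENNReal.mul_ne_top (by simp) hFt)).1 ?_
      refine le_trans (le_of_eq ?_) h1
      rw [← add_mul, ENNReal.inv_two_add_inv_two, one_mul]
    have hCL1 : ENNReal.ofReal CL⁻¹ * ENNReal.ofReal CL = 1 := by
      rw [← ENNReal.ofReal_mul (by positivity), inv_mul_cancel₀ hCL.ne', ENNReal.ofReal_one]
    calc ENNReal.ofReal (2 * CL)⁻¹ * F = ENNReal.ofReal CL⁻¹ * (2⁻¹ * F) := by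
          rw [mul_inv_rev, ENNReal.ofReal_mul (by positivity), ENNReal.ofReal_inv_of_pos two_pos,
            ENNReal.ofReal_ofNat, mul_assoc]
      _ ≤ ENNReal.ofReal CL⁻¹ * (ENNReal.ofReal CL * (ENNReal.ofReal (b ^ s) * X)) := by gcongr
      _ = _ := by rw [← mul_assoc, hCL1, one_mul]
  · calc ENNReal.ofReal (b ^ s) * X
        ≤ ENNReal.ofReal (b ^ s) * eLpNorm low p ν + ENNReal.ofReal (b ^ s) * eLpNorm high p ν := by
          rw [← mul_add]
          gcongr
      _ ≤ ENNReal.ofReal M * (F + ENNReal.ofReal η * F) + ENNReal.ofReal (M * η) * F := by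
          exact add_le_add (hLG.trans (mul_le_mul_right haF _)) hHG
      _ = ENNReal.ofReal (M * (1 + η) + M * η) * F := by
          rw [ENNReal.ofReal_add (by positivity) (by positivity),
            ENNReal.ofReal_mul (p := M) (q := 1 + η) hM0, ENNReal.ofReal_mul (p := M) (q := η) hM0,
            ENNReal.ofReal_add zero_le_one hη0.le, ENNReal.ofReal_one]
          ring
      _ ≤ _ := mul_le_mul_left (ENNReal.ofReal_le_ofReal (by linarith)) _

end Main

end BesovSampling

end

theorem theorem1p1 (d m : ℕ) (hm : 0 < m) (hmd : m ≤ d) (p : ℝ≥0∞) [Fact (1 ≤ p)] (hp : p ≠ ⊤)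
    (D : ℕ) :
    ∃ δ > (0 : ℝ), ∃ C₁ > (0 : ℝ), ∃ C₂ > (0 : ℝ),
      ∀ ρ : EuclideanSpace ℝ (Fin d) → ℝ, BesovSampling.IsDyadicPartition ρ →
      ∀ f : Lp ℂ p (volume : Measure (EuclideanSpace ℝ (Fin d))),
        BesovSampling.MemBesov ρ ((m : ℝ) / p.toReal) p f →
        (∃ g : EuclideanSpace ℝ (Fin d) → ℂ,
          BesovSampling.IsTraceRepresentative (Nat.sub_add_cancel hmd) p f g) ∧
        ∀ N b : ℝ, 0 < N → 0 < b →
          BesovSampling.homBesovNorm ρ ((m : ℝ) / p.toReal) p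
              (f : 𝓢'(EuclideanSpace ℝ (Fin d), ℂ))
            ≤ ENNReal.ofReal N * eLpNorm f p volume →
          b ^ ((m : ℝ) / p.toReal) < δ * N⁻¹ →
          ∀ E : Set (EuclideanSpace ℝ (Fin m)), DiscreteTopology E →
            ⋃ x ∈ E, BesovSampling.cube x b = univ →
            (∀ y : EuclideanSpace ℝ (Fin m), {x ∈ E | y ∈ BesovSampling.cube x b}.encard ≤ D) →
            ∀ g : EuclideanSpace ℝ (Fin d) → ℂ,
              BesovSampling.IsTraceRepresentative (Nat.sub_add_cancel hmd) p f g →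
              ENNReal.ofReal C₁ * eLpNorm f p volume
                  ≤ ENNReal.ofReal (b ^ ((m : ℝ) / p.toReal)) *
                    (∫⁻ x in BesovSampling.planes (Nat.sub_add_cancel hmd) E,
                      ‖g x‖ₑ ^ p.toReal ∂μHE[d - m]) ^ (1 / p.toReal) ∧
              ENNReal.ofReal (b ^ ((m : ℝ) / p.toReal)) *
                    (∫⁻ x in BesovSampling.planes (Nat.sub_add_cancel hmd) E,
                      ‖g x‖ₑ ^ p.toReal ∂μHE[d - m]) ^ (1 / p.toReal)
                  ≤ ENNReal.ofReal C₂ * eLpNorm f p volume := by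
  obtain ⟨δ, hδ, C₁, hC₁, C₂, hC₂, H⟩ :=
    BesovSampling.exists_sampling_constants (p := p) (Nat.sub_add_cancel hmd) hm hp D
  refine ⟨δ, hδ, C₁, hC₁, C₂, hC₂, fun ρ hρ f hf => ⟨?_, ?_⟩⟩
  -- Any splitting frequency yields a representative; 0 is an arbitrary choice.
  · obtain ⟨a, g, -, -, -, hrep⟩ := BesovSampling.exists_trace_decomposition
      (Nat.sub_add_cancel hmd) hm hp hρ f hf 0
    exact ⟨_, hrep⟩
  · intro N b hN hb hfN hbδ E hE hcover hD g hg
    have hEc := BesovSampling.countable_of_discreteTopology hE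
    rw [BesovSampling.lintegral_planes_eq_eLpNorm _ hp hEc]
    exact H ρ hρ f hf N b hN hb hfN hbδ E hEc hcover hD g hg
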